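/- For a half-line $[x_0,\infty)$ with $x_0\ge 0$, a smooth function $g:[x_0,\infty)\to\mathbb{R}$ belongs to $\mathcal{R}$ if for every integer $j\ge 0$ the quotient $x g^{(j+1)}(x)/g^{(j)}(x)$ is defined for all large $x$ and has a finite limit as $x\to\infty$. For an integer $i\ge 0$, let $\mathcal{T}_i$ be the set of $g\in\mathcal{R}$ such that $\lim_{x\to\infty} x g'(x)/g(x)=\alpha$ for some $\alpha$ with $i<\alpha\le i+1$, and $\lim_{x\to\infty} g^{(i+1)}(x)=0$; let $\mathcal{T}=\bigcup_{i\ge 0}\mathcal{T}_i$. Write $g_2\prec g_1$ if $|g_1(x)|/|g_2(x)|\to\infty$ as $x\to\infty$, and let $[x]$ be the largest integer $\le x$. For $E\subseteq\mathbb{Z}^\ell$ let $$d^*(E)=\sup_{(I_n)}\ \limsup_{n\to\infty}\frac{|E\cap I_n|}{|I_n|}$$ be the upper Banach density of $E$, the supremum being over all sequences $(I_n)$ of boxes (products of $\ell$ finite intervals of integers) in $\mathbb{Z}^\ell$ all of whose side lengths tend to infinity. Let $\ell\ge 1$ and let $g_1,\dots,g_\ell\in\mathcal{T}$ satisfy $g_\ell\prec\dots\prec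 g_1$ and $\sum_{i=1}^\ell\lambda_i g_i\in\mathcal{T}$ for all $(\lambda_1,\dots,\lambda_\ell)\in\mathbb{R}^\ell\setminus\{\vec 0\}$. Then for every $E\subseteq\mathbb{Z}^\ell$, $$\liminf_{N\to\infty}\frac1N\sum_{n=1}^N d^*\Big(E\cap\big(E-([g_1(n)],\dots,[g_\ell(n)])\big)\Big)\ \ge\ \big(d^*(E)\big)^2 .$$ (The finitely many values of the $g_i(n)$ with $n$ to the left of the half-lines may be chosen arbitrarily.) -/

import Mathlib

open Filter Topology
open scoped ContDiff

noncomputable section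

namespace TemperedFn

/-- The class `C^∞(ℝ⁺)`, where `ℝ⁺` stands for some half-line `[x₀, ∞)` with `x₀ ≥ 0`. Functions are
represented by total functions on `ℝ` whose values to the left of `x₀` are irrelevant. -/
def SmoothNearTop (g : ℝ → ℝ) : Prop :=
  ∃ x₀ : ℝ, 0 ≤ x₀ ∧ ContDiffOn ℝ ∞ g (Set.Ici x₀)

/-- The class `𝓡`: smooth functions on a half-line such that for every `j ≥ 0` the ratio
`x g^{(j+1)}(x) / g^{(j)}(x)` is defined for all large `x` and has a finite limit as `x → ∞`. -/
def classR : Set (ℝ → ℝ) :=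
  {g | SmoothNearTop g ∧ ∀ j : ℕ,
    (∀ᶠ x in atTop, iteratedDeriv j g x ≠ 0) ∧
    ∃ c : ℝ, Tendsto (fun x : ℝ => x * iteratedDeriv (j + 1) g x / iteratedDeriv j g x)
      atTop (𝓝 c)}

/-- The class `𝓣_i`: functions `g ∈ 𝓡` such that `x g'(x) / g(x) → α` for some `i < α ≤ i + 1`,
and `g^{(i+1)}(x) → 0`. -/
def classTi (i : ℕ) : Set (ℝ → ℝ) :=
  {g | g ∈ classR ∧
    (∃ α : ℝ, (i : ℝ) < α ∧ α ≤ i + 1 ∧ Tendsto (fun x : ℝ => x * deriv g x / g x) atTop (𝓝 α)) ∧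
    Tendsto (iteratedDeriv (i + 1) g) atTop (𝓝 0)}

/-- The class `𝓣 = ⋃ i, 𝓣_i`. -/
def classT : Set (ℝ → ℝ) := ⋃ i : ℕ, classTi i

/-- `SlowerThan g₂ g₁` is the growth relation `g₂ ≺ g₁`, i.e. `|g₁(x)| / |g₂(x)| → ∞`. -/
def SlowerThan (g₂ g₁ : ℝ → ℝ) : Prop :=
  Tendsto (fun x : ℝ => |g₁ x| / |g₂ x|) atTop atTop

/-- The upper Banach density of `E ⊆ ℤ^ℓ`: the supremum, over all sequences of boxes
`I_n = ∏ i, [a_n(i), b_n(i)]` in `ℤ^ℓ` all of whose side lengths tend to infinity, of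
`limsup |E ∩ I_n| / |I_n|`. -/
def upperBanachDensity {ℓ : ℕ} (E : Set (Fin ℓ → ℤ)) : ℝ :=
  sSup {d : ℝ | ∃ a b : ℕ → Fin ℓ → ℤ,
    (∀ n, a n ≤ b n) ∧
    (∀ i, Tendsto (fun n => b n i - a n i) atTop atTop) ∧
    d = limsup (fun n => ((E ∩ Set.Icc (a n) (b n)).ncard : ℝ) / ((Set.Icc (a n) (b n)).ncard : ℝ))
      atTop}

end TemperedFn

end

/-! Exponential sums along every nontrivial combination of the g_i cancel, and this makes the
vectors v_n = ([g_1(n)],…,[g_ℓ(n)]) an ergodic sequence in ℤ^ℓ: the averages of e(v_n·θ) tend to 0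
for each θ ≠ 0 in the torus. Recurrence then follows as from the mean ergodic theorem, carried out
on the spectral side.

Cancellation. Up to sign, a function in 𝓣_i has an (i+1)-st derivative that decreases to 0 while x
times it tends to ∞ (`classT.exists_tempered`). Van der Corput differencing lowers the order of this
condition until Fejér's theorem applies (`Tempered.cesaroZero`). The vectors (g_i(n)) are then
equidistributed mod 1, also when twisted by a non-integral frequency, and a cutoff near the
discontinuity of the fractional part transfers the cancellation to the integer parts
(`cesaroZero_floor`).

Recurrence. Let 0 < c < d*(E) and let A = E ∩ I for a box I in which E has density above c. The
probability measure with density |∑_{k∈A} e(k·x)|²/|A| has v-th Fourier coefficient |A ∩ (A -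
v)|/|A|. A weak limit ν over such boxes satisfies c·Re ∫ e(v·x) dν ≤ d*(E ∩ (E - v)), and counting
the sums v_n + y with y ∈ A gives ∫ |N⁻¹ ∑ e(v_n·x)|² dν ≥ c (`exists_spectral_measure`). By
ergodicity the averages converge pointwise to the indicator of {0}, so ν{0} ≥ c, and the lower limit
sought is at least c·ν{0} ≥ c². Let c increase to d*(E). -/

namespace TemperedFn

open scoped ComplexConjugate
open MeasureTheory

/-! ### Cesàro averages and van der Corput's lemma -/

/-- A sequence whose Cesàro averages tend to `0`. -/
def CesaroZero (u : ℕ → ℂ) : Prop :=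
  Tendsto (fun N : ℕ => (N : ℝ)⁻¹ • ∑ n ∈ Finset.range N, u n) atTop (𝓝 0)

theorem CesaroZero.of_sum_bounded {u v : ℕ → ℂ} (hu : CesaroZero u) (C : ℝ)
    (h : ∀ N, ‖∑ n ∈ Finset.range N, v n - ∑ n ∈ Finset.range N, u n‖ ≤ C) : CesaroZero v := by
  have h0 : Tendsto (fun N : ℕ => (N : ℝ)⁻¹ • (∑ n ∈ Finset.range N, v n -
      ∑ n ∈ Finset.range N, u n)) atTop (𝓝 0) := by
    apply squeeze_zero_norm (a := fun N : ℕ => (N : ℝ)⁻¹ * C)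
    · intro N
      rw [norm_smul, Real.norm_of_nonneg (by positivity)]
      exact mul_le_mul_of_nonneg_left (h N) (by positivity)
    · simpa using (tendsto_inv_atTop_nhds_zero_nat (𝕜 := ℝ)).mul_const C
  have := h0.add hu
  simp only [← smul_add, sub_add_cancel, add_zero] at this
  exact this

theorem CesaroZero.shift {u : ℕ → ℂ} (hu : CesaroZero u) (hb : ∀ n, ‖u n‖ ≤ 1) (k : ℕ) :
    CesaroZero (fun n => u (n + k)) := by
  induction k with
  | zero => simpa using hu
  | succ k ih =>
    refine ih.of_sum_bounded 2 fun N => ?_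
    have h := Finset.sum_range_succ' (fun n => u (n + k)) N
    have h' := Finset.sum_range_succ (fun n => u (n + k)) N
    have e : ∑ n ∈ Finset.range N, u (n + (k + 1)) - ∑ n ∈ Finset.range N, u (n + k)
        = u (N + k) - u (0 + k) := by
      have e2 : ∑ n ∈ Finset.range N, u (n + (k + 1)) = ∑ n ∈ Finset.range N, u (n + 1 + k) :=
        Finset.sum_congr rfl fun n _ => by congr 1; ring
      rw [e2]
      linear_combination h' - h
    rw [e]
    calc _ ≤ ‖u (N + k)‖ + ‖u (0 + k)‖ := norm_sub_le _ _
      _ ≤ 2 := by linarith [hb (N + k), hb (0 + k)]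

theorem CesaroZero.conj {u : ℕ → ℂ} (hu : CesaroZero u) : CesaroZero (fun n => conj (u n)) := by
  have := (Complex.continuous_conj.tendsto 0).comp hu
  simpa [CesaroZero, Function.comp_def, Complex.real_smul, map_sum] using this

theorem CesaroZero.const_mul {u : ℕ → ℂ} (hu : CesaroZero u) (c : ℂ) :
    CesaroZero (fun n => c * u n) := by
  have := Tendsto.const_mul c hu
  simp only [mul_smul_comm, Finset.mul_sum, mul_zero] at this
  exact this

theorem CesaroZero.add {u v : ℕ → ℂ} (hu : CesaroZero u) (hv : CesaroZero v) :
    CesaroZero (fun n => u n + v n) := by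
  have := Tendsto.add hu hv
  simpa [CesaroZero, Finset.sum_add_distrib] using this

/-- The van der Corput lemma for unimodular sequences. -/
theorem cesaroZero_of_correlations {u : ℕ → ℂ} (hu : ∀ n, ‖u n‖ = 1)
    (hc : ∀ h : ℕ, 1 ≤ h → CesaroZero (fun n => u (n + h) * conj (u n))) : CesaroZero u := by
  have hcorr : ∀ h h' : ℕ, h ≠ h' → CesaroZero (fun n => u (n + h) * conj (u (n + h'))) := by
    have key : ∀ h h' : ℕ, h' < h → CesaroZero (fun n => u (n + h) * conj (u (n + h'))) := by
      intro h h' hlt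
      have := (hc (h - h') (by omega)).shift (by simp [hu]) h'
      have e : ∀ n, n + h' + (h - h') = n + h := fun n => by omega
      simpa only [e] using this
    intro h h' hne
    rcases lt_or_gt_of_ne hne with hlt | hlt
    · have := (key h' h hlt).conj
      simpa [mul_comm] using this
    · exact key h h' hlt
  -- Expanding the square, the H diagonal terms each average to 1 and the off-diagonal correlations
  -- average to 0.
  have hQ : ∀ H : ℕ, 1 ≤ H → Tendsto (fun N : ℕ => (N : ℝ)⁻¹ * ∑ n ∈ Finset.range N,
      ‖∑ h ∈ Finset.range H, u (n + h)‖ ^ 2) atTop (𝓝 H) := by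
    intro H hH
    have h1 : Tendsto (fun N : ℕ => ∑ h ∈ Finset.range H, ∑ h' ∈ Finset.range H,
        (N : ℝ)⁻¹ • ∑ n ∈ Finset.range N, u (n + h) * conj (u (n + h'))) atTop
        (𝓝 (∑ h ∈ Finset.range H, ∑ h' ∈ Finset.range H, if h = h' then 1 else 0)) := by
      refine tendsto_finsetSum _ fun h _ => tendsto_finsetSum _ fun h' _ => ?_
      split_ifs with hh
      · subst hh
        refine tendsto_const_nhds.congr' ?_
        filter_upwards [eventually_gt_atTop 0] with N hN
        have : ∀ n, u (n + h) * conj (u (n + h)) = 1 := by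
          intro n; rw [Complex.mul_conj, Complex.normSq_eq_norm_sq, hu]; simp
        have hN' : (N : ℂ) ≠ 0 := by exact_mod_cast hN.ne'
        simp [this, hN']
      · exact hcorr h h' hh
    have h2 : (∑ h ∈ Finset.range H, ∑ h' ∈ Finset.range H, if h = h' then (1 : ℂ) else 0)
        = ((H : ℝ) : ℂ) := by
      have : ∀ h ∈ Finset.range H,
          (∑ h' ∈ Finset.range H, if h = h' then (1 : ℂ) else 0) = 1 := by
        intro h hh; rw [Finset.sum_ite_eq, if_pos hh]
      rw [Finset.sum_congr rfl this]; simp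
    rw [h2] at h1
    have h3 := (Complex.continuous_re.tendsto _).comp h1
    rw [Complex.ofReal_re] at h3
    refine h3.congr fun N => ?_
    have h4 : ∀ n, (((‖∑ h ∈ Finset.range H, u (n + h)‖ ^ 2 : ℝ)) : ℂ) =
        ∑ h ∈ Finset.range H, ∑ h' ∈ Finset.range H, u (n + h) * conj (u (n + h')) := by
      intro n
      rw [← Complex.normSq_eq_norm_sq, ← Complex.mul_conj, map_sum, Finset.sum_mul_sum]
    have h5 : (((N : ℝ)⁻¹ * ∑ n ∈ Finset.range N,
      ‖∑ h ∈ Finset.range H, u (n + h)‖ ^ 2 : ℝ) : ℂ) = ∑ h ∈ Finset.range H,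
        ∑ h' ∈ Finset.range H,
        (N : ℝ)⁻¹ • ∑ n ∈ Finset.range N, u (n + h) * conj (u (n + h')) := by
      rw [Complex.ofReal_mul, Complex.ofReal_sum, Finset.sum_congr rfl (fun n _ => h4 n),
        Finset.sum_comm, Finset.mul_sum]
      refine Finset.sum_congr rfl fun h _ => ?_
      rw [Finset.sum_comm, Finset.mul_sum]
      simp [Complex.real_smul]
    rw [Function.comp_apply, ← h5, Complex.ofReal_re]
  have hS : ∀ H : ℕ, Tendsto (fun N : ℕ => (N : ℝ)⁻¹ • ∑ n ∈ Finset.range N,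
      ∑ h ∈ Finset.range H, (u n - u (n + h))) atTop (𝓝 0) := by
    intro H
    have h1 : Tendsto (fun N : ℕ => ∑ h ∈ Finset.range H, (N : ℝ)⁻¹ • ∑ n ∈ Finset.range N,
        (u n - u (n + h))) atTop (𝓝 (∑ h ∈ Finset.range H, 0)) := by
      refine tendsto_finsetSum _ fun h hmem => ?_
      clear hmem
      have h0 : CesaroZero (fun _ => 0) := by simp [CesaroZero]
      refine h0.of_sum_bounded (2 * h) fun N => ?_
      rw [Finset.sum_const_zero, sub_zero]
      induction h with
      | zero => simp
      | succ h ih =>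
        have e : ∑ n ∈ Finset.range N, (u n - u (n + (h + 1))) =
            ∑ n ∈ Finset.range N, (u n - u (n + h)) - (u (N + h) - u (0 + h)) := by
          rw [← Finset.sum_range_sub (fun n => u (n + h)), ← Finset.sum_sub_distrib]
          refine Finset.sum_congr rfl fun n _ => ?_
          rw [show n + 1 + h = n + (h + 1) by ring]; ring
        rw [e]
        push_cast
        calc _ ≤ ‖∑ n ∈ Finset.range N, (u n - u (n + h))‖ + ‖u (N + h) - u (0 + h)‖ :=
              norm_sub_le _ _
          _ ≤ 2 * h + (‖u (N + h)‖ + ‖u (0 + h)‖) := add_le_add ih (norm_sub_le _ _)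
          _ = _ := by rw [hu, hu]; ring
    rw [Finset.sum_const_zero] at h1
    refine h1.congr fun N => ?_
    rw [← Finset.smul_sum, Finset.sum_comm]
  rw [CesaroZero, Metric.tendsto_atTop']
  intro ε hε
  -- The bound H > 8/ε² gives 2H ≤ (Hε/2)², which turns the mean-square bound on `V` into ‖V‖ ≤
  -- Hε/2; H ≥ 1 absorbs the remaining error ε/2.
  obtain ⟨H, hH⟩ := exists_nat_gt (max 1 (4 / ε ^ 2 * 2))
  have hH1 : 1 ≤ H := by
    have : (1 : ℝ) < H := lt_of_le_of_lt (le_max_left _ _) hH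
    exact_mod_cast this.le
  have hHr : (0 : ℝ) < H := by exact_mod_cast hH1
  have hH2 : 4 / ε ^ 2 * 2 < H := lt_of_le_of_lt (le_max_right _ _) hH
  have e1 : ∀ᶠ N : ℕ in atTop, (N : ℝ)⁻¹ * ∑ n ∈ Finset.range N,
      ‖∑ h ∈ Finset.range H, u (n + h)‖ ^ 2 < 2 * H :=
    (hQ H hH1).eventually_lt_const (by linarith)
  have e2 : ∀ᶠ N : ℕ in atTop, ‖(N : ℝ)⁻¹ • ∑ n ∈ Finset.range N,
      ∑ h ∈ Finset.range H, (u n - u (n + h))‖ < ε / 2 := by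
    have := (hS H).norm
    rw [norm_zero] at this
    exact this.eventually_lt_const (by linarith)
  obtain ⟨N₀, hN₀⟩ := eventually_atTop.1 (e1.and (e2.and (eventually_gt_atTop 0)))
  refine ⟨N₀, fun N hN => ?_⟩
  obtain ⟨a1, a2, a3⟩ := hN₀ N hN.le
  have hNr : (0 : ℝ) < N := by exact_mod_cast a3
  rw [dist_zero_right]
  set V : ℂ := (N : ℝ)⁻¹ • ∑ n ∈ Finset.range N, ∑ h ∈ Finset.range H, u (n + h) with hV
  have hVn : ‖V‖ ^ 2 ≤ 2 * H := by
    refine le_trans ?_ a1.le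
    rw [hV, norm_smul, Real.norm_of_nonneg (by positivity), mul_pow]
    have b1 : ‖∑ n ∈ Finset.range N, ∑ h ∈ Finset.range H, u (n + h)‖ ^ 2 ≤
        N * ∑ n ∈ Finset.range N, ‖∑ h ∈ Finset.range H, u (n + h)‖ ^ 2 := by
      calc _ ≤ (∑ n ∈ Finset.range N, ‖∑ h ∈ Finset.range H, u (n + h)‖) ^ 2 := by
            gcongr; exact norm_sum_le _ _
        _ ≤ _ := by
            have := sq_sum_le_card_mul_sum_sq (s := Finset.range N)
              (f := fun n => ‖∑ h ∈ Finset.range H, u (n + h)‖)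
            simpa using this
    calc _ ≤ ((N : ℝ)⁻¹) ^ 2 * (N * ∑ n ∈ Finset.range N,
          ‖∑ h ∈ Finset.range H, u (n + h)‖ ^ 2) := by gcongr
      _ = _ := by field_simp
  have hdec : (H : ℂ) * ((N : ℝ)⁻¹ • ∑ n ∈ Finset.range N, u n) =
      (N : ℝ)⁻¹ • (∑ n ∈ Finset.range N, ∑ h ∈ Finset.range H, (u n - u (n + h))) + V := by
    rw [hV, ← smul_add, ← Finset.sum_add_distrib, mul_smul_comm, Finset.mul_sum]
    congr 1
    refine Finset.sum_congr rfl fun n _ => ?_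
    rw [Finset.sum_sub_distrib]; simp
  have hfin : H * ‖(N : ℝ)⁻¹ • ∑ n ∈ Finset.range N, u n‖ < ε / 2 + H * (ε / 2) := by
    have c1 : (H : ℝ) * ‖(N : ℝ)⁻¹ • ∑ n ∈ Finset.range N, u n‖ =
        ‖(H : ℂ) * ((N : ℝ)⁻¹ • ∑ n ∈ Finset.range N, u n)‖ := by
      rw [norm_mul]; simp
    rw [c1, hdec]
    have c2 : ‖V‖ ≤ H * (ε / 2) := by
      apply abs_le_of_sq_le_sq' _ (by positivity) |>.2
      refine hVn.trans ?_
      rw [div_mul_eq_mul_div, div_lt_iff₀ (by positivity)] at hH2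
      nlinarith
    linarith [norm_add_le ((N : ℝ)⁻¹ • (∑ n ∈ Finset.range N,
      ∑ h ∈ Finset.range H, (u n - u (n + h)))) V]
  have : (1 : ℝ) ≤ H := by exact_mod_cast hH1
  by_contra! hcon
  nlinarith

/-! ### Exponential sums along tempered functions -/

/-- The additive character `x ↦ exp (2πix)` of `ℝ`. -/
noncomputable def expChar (x : ℝ) : ℂ := Complex.exp (((2 * Real.pi * x : ℝ) : ℂ) * Complex.I)

theorem norm_expChar (x : ℝ) : ‖expChar x‖ = 1 := Complex.norm_exp_ofReal_mul_I _

theorem expChar_add (x y : ℝ) : expChar (x + y) = expChar x * expChar y := by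
  rw [expChar, expChar, expChar, ← Complex.exp_add]; congr 1; push_cast; ring

theorem expChar_neg (x : ℝ) : expChar (-x) = conj (expChar x) := by
  rw [expChar, expChar, ← Complex.exp_conj]; congr 1
  rw [map_mul, Complex.conj_ofReal, Complex.conj_I]; push_cast; ring

theorem expChar_sub (x y : ℝ) : expChar (x - y) = expChar x * conj (expChar y) := by
  rw [sub_eq_add_neg, expChar_add, expChar_neg]

/-- `Tempered k f`: the `k`-th derivative of `f` is eventually defined and antitone, tends to `0`,
and tends to `∞` after multiplication by `x`. -/
def Tempered : ℕ → (ℝ → ℝ) → Prop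
  | 0, f => (∃ X, AntitoneOn f (Set.Ici X)) ∧ Tendsto f atTop (𝓝 0) ∧
      Tendsto (fun x => x * f x) atTop atTop
  | k + 1, f => ∃ f' : ℝ → ℝ, (∀ᶠ x in atTop, HasDerivAt f (f' x) x) ∧ Tempered k f'

theorem Tempered.of_chain {F : ℕ → ℝ → ℝ}
    (hF : ∀ j, ∀ᶠ x in atTop, HasDerivAt (F j) (F (j + 1) x) x) (k j : ℕ)
    (h : Tempered 0 (F (j + k))) : Tempered k (F j) := by
  induction k generalizing j with
  | zero => exact h
  | succ k ih =>
    exact ⟨F (j + 1), hF j, ih (j + 1) (by rwa [show j + 1 + k = j + (k + 1) by ring])⟩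

/-- Differencing commutes with differentiation, which reduces everything to order zero. There the
mean value theorem squeezes the difference between h f'(x + h) and h f'(x), and it is antitone
because its derivative f'(x + h) - f'(x) is nonpositive. -/
theorem Tempered.difference {k : ℕ} {f : ℝ → ℝ} (hf : Tempered (k + 1) f) {h : ℝ} (hh : 0 < h) :
    Tempered k (fun x => f (x + h) - f x) := by
  have hsh : Tendsto (fun x : ℝ => x + h) atTop atTop := tendsto_atTop_add_const_right _ _ tendsto_id
  induction k generalizing f with
  | succ k ih =>
    obtain ⟨f', hd, hT⟩ := hf
    refine ⟨fun x => f' (x + h) - f' x, ?_, ih hT⟩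
    filter_upwards [hd, hsh.eventually hd] with x h1 h2
    exact (h2.comp_add_const x h).sub h1
  | zero =>
    obtain ⟨f', hd, ⟨X₀, hX₀⟩, h0, hinf⟩ := hf
    obtain ⟨X₁, hX₁⟩ := eventually_atTop.1 hd
    set X := max X₀ X₁ with hX
    have hanti : AntitoneOn f' (Set.Ici X) := hX₀.mono (Set.Ici_subset_Ici.2 (le_max_left _ _))
    have hder : ∀ x, X ≤ x → HasDerivAt f (f' x) x := fun x hx =>
      hX₁ x ((le_max_right _ _).trans hx)
    have bd : ∀ x, X ≤ x → h * f' (x + h) ≤ f (x + h) - f x ∧ f (x + h) - f x ≤ h * f' x := by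
      intro x hx
      obtain ⟨c, hc, hce⟩ := exists_hasDerivAt_eq_slope f f' (show x < x + h by linarith)
        (fun y hy => (hder y (hx.trans hy.1)).continuousAt.continuousWithinAt)
        (fun y hy => hder y (hx.trans hy.1.le))
      rw [add_sub_cancel_left, eq_div_iff hh.ne'] at hce
      have a1 : f' (x + h) ≤ f' c := hanti (hx.trans hc.1.le) (hx.trans (by linarith)) hc.2.le
      have a2 : f' c ≤ f' x := hanti hx (hx.trans hc.1.le) hc.1.le
      constructor <;> nlinarith
    have hbd : ∀ᶠ x in atTop, h * f' (x + h) ≤ f (x + h) - f x ∧ f (x + h) - f x ≤ h * f' x :=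
      eventually_atTop.2 ⟨X, bd⟩
    refine ⟨⟨X, ?_⟩, ?_, ?_⟩
    · refine antitoneOn_of_deriv_nonpos (convex_Ici X) ?_ ?_ ?_
      · intro x hx
        exact (((hder (x + h) (by simp at hx ⊢; linarith)).comp_add_const x h).sub
          (hder x hx)).continuousAt.continuousWithinAt
      · intro x hx
        rw [interior_Ici] at hx
        have hx' : X ≤ x := le_of_lt hx
        exact (((hder (x + h) (by linarith)).comp_add_const x h).sub
          (hder x hx')).differentiableAt.differentiableWithinAt
      · intro x hx
        rw [interior_Ici] at hx
        have hx' : X ≤ x := le_of_lt hx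
        have := (((hder (x + h) (by linarith)).comp_add_const x h).sub (hder x hx')).deriv
        have e : deriv (fun x => f (x + h) - f x) x = f' (x + h) - f' x := this
        rw [e]
        have : f' (x + h) ≤ f' x := hanti hx' (show X ≤ x + h by linarith) (by linarith)
        linarith
    · refine tendsto_of_tendsto_of_tendsto_of_le_of_le' (g := fun x => h * f' (x + h))
        (h := fun x => h * f' x) ?_ ?_ (hbd.mono fun _ h => h.1) (hbd.mono fun _ h => h.2)
      · simpa using (h0.comp hsh).const_mul h
      · simpa using h0.const_mul h
    -- The factor 1/2 comes from x ≥ (x + h)/2, valid once x ≥ h.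
    · have hinf' := (hinf.comp hsh).atTop_mul_const (show 0 < h / 2 by positivity)
      refine tendsto_atTop_mono' _ ?_ hinf'
      filter_upwards [hbd, eventually_ge_atTop h, hsh.eventually (hinf.eventually_ge_atTop 0)]
        with x hx hxh hpos
      simp only [Function.comp_apply]
      have hx0 : 0 < x := hh.trans_le hxh
      have f0 : 0 ≤ f' (x + h) := by
        by_contra! hneg
        nlinarith
      have : x * (h * f' (x + h)) ≤ x * (f (x + h) - f x) := mul_le_mul_of_nonneg_left hx.1 hx0.le
      have h3 : (x + h) * (f' (x + h) * h) ≤ (x + x) * (f' (x + h) * h) := by gcongr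
      linarith

theorem cesaroZero_of_sum_small {u r : ℕ → ℂ} (hr : Tendsto r atTop (𝓝 0)) {B : ℕ → ℝ}
    (hB : Tendsto (fun N : ℕ => (N : ℝ)⁻¹ * B N) atTop (𝓝 0))
    (h : ∀ᶠ N in atTop, ‖∑ n ∈ Finset.range N, (u n - r n)‖ ≤ B N) : CesaroZero u := by
  have h1 : CesaroZero (fun n => u n - r n) := by
    refine squeeze_zero_norm' ?_ hB
    filter_upwards [h] with N hN
    rw [norm_smul, Real.norm_of_nonneg (by positivity)]
    gcongr
  have h2 : CesaroZero r := hr.cesaro_smul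
  simpa using h1.add h2

/-- Fejér's theorem on exponential sums. -/
theorem Tempered.cesaroZero_one {f : ℝ → ℝ} (hf : Tempered 1 f) :
    CesaroZero (fun n => expChar (f n)) := by
  obtain ⟨⟨X, hanti⟩, h0, hinf⟩ := hf.difference one_pos
  set d : ℕ → ℝ := fun n => f (n + 1) - f n with hd
  have h0' : Tendsto d atTop (𝓝 0) := h0.comp tendsto_natCast_atTop_atTop
  have hinf' : Tendsto (fun n : ℕ => (n : ℝ) * d n) atTop atTop :=
    hinf.comp tendsto_natCast_atTop_atTop
  obtain ⟨n₀, hn₀⟩ := exists_nat_ge X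
  obtain ⟨n₁, hn₁⟩ := eventually_atTop.1 (hinf'.eventually_gt_atTop 0)
  set m := max n₀ n₁
  have hpos : ∀ n, m ≤ n → 0 < d n := fun n hn => by
    have := hn₁ n ((le_max_right _ _).trans hn)
    exact pos_of_mul_pos_right this (by positivity)
  have hda : ∀ n, m ≤ n → d (n + 1) ≤ d n := fun n hn => by
    have hXn : X ≤ n := hn₀.trans (by exact_mod_cast (le_max_left _ _).trans hn)
    have := hanti (a := (n : ℝ)) hXn (b := (n : ℝ) + 1) (show X ≤ (n : ℝ) + 1 by linarith)
      (by linarith)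
    simpa [hd] using this
  set E : ℕ → ℂ := fun n => expChar (f n) with hE
  have hEn : ∀ n, ‖E n‖ = 1 := fun n => norm_expChar _
  have hstep : ∀ n, E (n + 1) = E n * expChar (d n) := fun n => by
    simp only [hE, hd]; rw [← expChar_add]; push_cast; congr 1; ring
  set w : ℕ → ℂ := fun n => (((d n)⁻¹ : ℝ) : ℂ) with hw
  have hwmono : ∀ n, m ≤ n → ‖w n - w (n + 1)‖ = (d (n + 1))⁻¹ - (d n)⁻¹ := fun n hn => by
    rw [hw, ← Complex.ofReal_sub, Complex.norm_real, Real.norm_eq_abs, abs_sub_comm, abs_of_nonneg]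
    have := inv_anti₀ (hpos (n + 1) (by omega)) (hda n hn)
    linarith
  set c : ℂ := 2 * Real.pi * Complex.I with hc
  have hc0 : c ≠ 0 := by
    simp [hc, Real.pi_ne_zero]
  -- Abel summation from `m` on: since `d` decreases, the weights 1/d are monotone and their total
  -- variation telescopes. Everything is O(1/d N), which is o(N) because N d N → ∞.
  have hT : ∀ N, m ≤ N → ‖∑ n ∈ Finset.range N, w n * (E (n + 1) - E n) - w N * E N‖ ≤
      ‖∑ n ∈ Finset.range m, w n * (E (n + 1) - E n) - w m * E m‖ + (d N)⁻¹ - (d m)⁻¹ := by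
    intro N hN
    induction N, hN using Nat.le_induction with
    | base => simp
    | succ N hN ih =>
      have e : ∑ n ∈ Finset.range (N + 1), w n * (E (n + 1) - E n) - w (N + 1) * E (N + 1) =
        (∑ n ∈ Finset.range N, w n * (E (n + 1) - E n) - w N * E N) +
          (w N - w (N + 1)) * E (N + 1) := by
        rw [Finset.sum_range_succ]; ring
      rw [e]
      refine (norm_add_le _ _).trans ?_
      rw [norm_mul, hEn, mul_one, hwmono N hN]
      linarith
  -- To first order E (n + 1) - E n is c · d n · E n, so c · E n is the weighted increment w n (E (n
  -- + 1) - E n) up to an error (2π)² d n → 0.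
  have hmain : CesaroZero (fun n => c * E n) := by
    refine cesaroZero_of_sum_small (r := fun n => c * E n - w n * (E (n + 1) - E n))
      (B := fun N => ‖∑ n ∈ Finset.range m, w n * (E (n + 1) - E n) - w m * E m‖ + 2 * (d N)⁻¹)
      ?_ ?_ ?_
    · refine squeeze_zero_norm' (a := fun n => (2 * Real.pi) ^ 2 * d n) ?_ ?_
      · have hsmall : ∀ᶠ n in atTop, d n < 1 / (2 * Real.pi) :=
          h0'.eventually_lt_const (by positivity)
        filter_upwards [hsmall, eventually_ge_atTop m] with n hn hnm
        have hdn := hpos n hnm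
        have e : c * E n - w n * (E (n + 1) - E n) =
            -(w n * E n * (Complex.exp (c * d n) - 1 - c * d n)) := by
          have : expChar (d n) = Complex.exp (c * d n) := by
            rw [expChar, hc]; congr 1; push_cast; ring
          have hwd : w n * d n = 1 := by
            rw [hw, ← Complex.ofReal_mul, inv_mul_cancel₀ hdn.ne', Complex.ofReal_one]
          rw [hstep, this]
          linear_combination -c * E n * hwd
        have hnc : ‖c * d n‖ = 2 * Real.pi * d n := by
          rw [hc]; simp [abs_of_pos Real.pi_pos, abs_of_pos hdn]
        rw [e, norm_neg, norm_mul, norm_mul, hEn, mul_one]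
        have := Complex.norm_exp_sub_one_sub_id_le (x := c * d n) (by
          rw [hnc]; rw [lt_div_iff₀ (by positivity)] at hn; linarith)
        rw [hnc] at this
        have hwn : ‖w n‖ = (d n)⁻¹ := by
          rw [hw, Complex.norm_real, Real.norm_of_nonneg (by positivity)]
        rw [hwn]
        calc _ ≤ (d n)⁻¹ * (2 * Real.pi * d n) ^ 2 := by gcongr
          _ = _ := by field_simp
      · simpa using h0'.const_mul ((2 * Real.pi) ^ 2)
    · have h1 := (tendsto_inv_atTop_nhds_zero_nat (𝕜 := ℝ)).mul_const
        ‖∑ n ∈ Finset.range m, w n * (E (n + 1) - E n) - w m * E m‖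
      have h2 := hinf'.inv_tendsto_atTop.const_mul 2
      have h3 := h1.add h2
      simp only [zero_mul, mul_zero, add_zero] at h3
      refine h3.congr fun N => ?_
      simp only [Pi.inv_apply, mul_inv]; ring
    · filter_upwards [eventually_ge_atTop m] with N hN
      have := hT N hN
      simp only [sub_sub_cancel]
      have e : ∑ n ∈ Finset.range N, w n * (E (n + 1) - E n) =
        (∑ n ∈ Finset.range N, w n * (E (n + 1) - E n) - w N * E N) + w N * E N := by ring
      rw [e]
      have hwn : ‖w N * E N‖ = (d N)⁻¹ := by
        rw [norm_mul, hEn, hw, Complex.norm_real,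
          Real.norm_of_nonneg (inv_nonneg.2 (hpos N hN).le), mul_one]
      have hm : 0 ≤ (d m)⁻¹ := inv_nonneg.2 (hpos m le_rfl).le
      refine (norm_add_le _ _).trans ?_
      rw [hwn]
      linarith
  have := hmain.const_mul c⁻¹
  simpa [hc0] using this

/-- Each correlation is the exponential sum of a difference of `f`, tempered of one order less, so
van der Corput's lemma drives an induction that starts at Fejér's theorem. -/
theorem Tempered.cesaroZero {k : ℕ} {f : ℝ → ℝ} (hf : Tempered (k + 1) f) :
    CesaroZero (fun n => expChar (f n)) := by
  induction k generalizing f with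
  | zero => exact hf.cesaroZero_one
  | succ k ih =>
    refine cesaroZero_of_correlations (fun n => norm_expChar _) fun h hh => ?_
    have := ih (hf.difference (h := h) (by exact_mod_cast hh))
    simpa [expChar_sub] using this

/-! ### From the class 𝓣 to tempered functions -/

theorem SmoothNearTop.hasDerivAt_iteratedDeriv {g : ℝ → ℝ} (hg : SmoothNearTop g) (j : ℕ) :
    ∀ᶠ x in atTop, HasDerivAt (iteratedDeriv j g) (iteratedDeriv (j + 1) g x) x := by
  obtain ⟨x₀, -, h⟩ := hg
  filter_upwards [eventually_gt_atTop x₀] with x hx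
  have hs : ContDiffOn ℝ ∞ g (Set.Ioi x₀) := h.mono Set.Ioi_subset_Ici_self
  have hd := hs.differentiableOn_iteratedDerivWithin (m := j)
    (by exact_mod_cast WithTop.coe_lt_top _) (uniqueDiffOn_Ioi x₀)
  have hd' : DifferentiableOn ℝ (iteratedDeriv j g) (Set.Ioi x₀) :=
    hd.congr fun y hy => (iteratedDerivWithin_of_isOpen isOpen_Ioi hy).symm
  have := (hd'.differentiableAt (Ioi_mem_nhds hx)).hasDerivAt
  rwa [iteratedDeriv_succ]

/-- If `x q'(x) / q(x)` eventually exceeds a positive constant, then `log |q|` tends to infinity. -/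
theorem tendsto_log_atTop_of_logDeriv {q q' : ℝ → ℝ} {L : ℝ} (hL : 0 < L)
    (hq : ∀ᶠ x in atTop, HasDerivAt q (q' x) x) (h0 : ∀ᶠ x in atTop, q x ≠ 0)
    (hlim : Tendsto (fun x => x * q' x / q x) atTop (𝓝 L)) :
    Tendsto (fun x => Real.log (q x)) atTop atTop := by
  obtain ⟨X, hX⟩ := eventually_atTop.1 ((hq.and h0).and
    ((hlim.eventually_const_lt (half_lt_self hL)).and (eventually_gt_atTop 0)))
  -- The derivative is (x q'/q - L/2)/x, nonnegative for large x; hence log |q| outgrows (L/2) log x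
  -- up to a constant. `Real.log` of a negative number is the logarithm of its absolute value.
  have hder : ∀ x, X ≤ x → HasDerivAt (fun x => Real.log (q x) - L / 2 * Real.log x)
      (q' x / q x - L / 2 * x⁻¹) x := fun x hx =>
    ((hX x hx).1.1.log (hX x hx).1.2).sub
      ((Real.hasDerivAt_log (hX x hx).2.2.ne').const_mul (L / 2))
  have hmono : MonotoneOn (fun x => Real.log (q x) - L / 2 * Real.log x) (Set.Ici X) := by
    refine monotoneOn_of_deriv_nonneg (convex_Ici X)
      (fun x hx => (hder x hx).continuousAt.continuousWithinAt)
      (fun x hx => (hder x (interior_subset hx)).differentiableAt.differentiableWithinAt)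
      fun x hx => ?_
    have hx' := interior_subset hx
    rw [(hder x hx').deriv]
    have h1 := (hX x hx').2.1
    have hx0 := (hX x hx').2.2
    have : q' x / q x = (x * q' x / q x) * x⁻¹ := by field_simp
    rw [this, ← sub_mul]
    exact mul_nonneg (by linarith) (by positivity)
  have hlog := (Real.tendsto_log_atTop.const_mul_atTop (half_pos hL)).atTop_add
    (tendsto_const_nhds (x := Real.log (q X) - L / 2 * Real.log X))
  refine tendsto_atTop_mono' _ ?_ hlog
  filter_upwards [eventually_ge_atTop X] with x hx
  have := hmono (a := X) (b := x) (Set.mem_Ici.2 le_rfl) hx hx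
  simp only at this
  linarith

theorem tendsto_abs_atTop_of_logDeriv {q q' : ℝ → ℝ} {L : ℝ} (hL : 0 < L)
    (hq : ∀ᶠ x in atTop, HasDerivAt q (q' x) x) (h0 : ∀ᶠ x in atTop, q x ≠ 0)
    (hlim : Tendsto (fun x => x * q' x / q x) atTop (𝓝 L)) :
    Tendsto (fun x => |q x|) atTop atTop := by
  refine (Real.tendsto_exp_atTop.comp (tendsto_log_atTop_of_logDeriv hL hq h0 hlim)).congr' ?_
  filter_upwards [h0] with x hx
  rw [Function.comp_apply, ← Real.log_abs, Real.exp_log (abs_pos.2 hx)]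

/-- A function with a finite nonzero limit has vanishing logarithmic index. -/
theorem logDeriv_limit_eq_zero {q q' : ℝ → ℝ} {L c : ℝ} (hc : c ≠ 0)
    (hq : ∀ᶠ x in atTop, HasDerivAt q (q' x) x) (hqc : Tendsto q atTop (𝓝 c))
    (hlim : Tendsto (fun x => x * q' x / q x) atTop (𝓝 L)) : L = 0 := by
  have h0 : ∀ᶠ x in atTop, q x ≠ 0 := hqc.eventually_ne hc
  rcases lt_trichotomy L 0 with hL | hL | hL
  · have hq2 : ∀ᶠ x in atTop, HasDerivAt (fun x => (q x)⁻¹) (-q' x / q x ^ 2) x := by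
      filter_upwards [hq, h0] with x h1 h2 using h1.inv h2
    have := tendsto_abs_atTop_of_logDeriv (L := -L) (by linarith) hq2
      (h0.mono fun x hx => inv_ne_zero hx) (by
        refine hlim.neg.congr' ?_
        filter_upwards [h0] with x hx
        field_simp)
    exact absurd (hqc.inv₀ hc).abs (not_tendsto_nhds_of_tendsto_atTop this _)
  · exact hL
  · exact absurd hqc.abs (not_tendsto_nhds_of_tendsto_atTop
      (tendsto_abs_atTop_of_logDeriv hL hq h0 hlim) _)

/-- Membership in 𝓡 only says that the next index b exists. The quotient q = x y'/y has index 1 + b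
- c, and this must vanish because q tends to c ≠ 0. -/
theorem classR.index_step {g : ℝ → ℝ} (hg : g ∈ classR) {j : ℕ} {c : ℝ} (hc : c ≠ 0)
    (h : Tendsto (fun x : ℝ => x * iteratedDeriv (j + 1) g x / iteratedDeriv j g x)
      atTop (𝓝 c)) :
    Tendsto (fun x : ℝ => x * iteratedDeriv (j + 2) g x / iteratedDeriv (j + 1) g x)
      atTop (𝓝 (c - 1)) := by
  obtain ⟨hs, hR⟩ := hg
  obtain ⟨b, hb⟩ := (hR (j + 1)).2
  have hd0 := hs.hasDerivAt_iteratedDeriv j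
  have hd1 := hs.hasDerivAt_iteratedDeriv (j + 1)
  have hn0 := (hR j).1
  have hn1 := (hR (j + 1)).1
  set y := iteratedDeriv j g
  set y' := iteratedDeriv (j + 1) g
  set y'' := iteratedDeriv (j + 1 + 1) g
  have hq : ∀ᶠ x in atTop, HasDerivAt (fun x => x * y' x / y x)
      (((1 * y' x + x * y'' x) * y x - x * y' x * y' x) / y x ^ 2) x := by
    filter_upwards [hd0, hd1, hn0] with x h0 h1 h2
    exact ((hasDerivAt_id x).mul h1).div h0 h2
  have hlim : Tendsto (fun x => x * (((1 * y' x + x * y'' x) * y x - x * y' x * y' x) / y x ^ 2) /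
      (x * y' x / y x)) atTop (𝓝 (1 + b - c)) := by
    refine ((hb.const_add 1).sub h).congr' ?_
    filter_upwards [hn0, hn1, eventually_gt_atTop 0] with x h0 h1 h2
    field_simp
  have := logDeriv_limit_eq_zero hc hq h hlim
  rwa [show c - 1 = b by linarith]

theorem classR.index_eq {g : ℝ → ℝ} (hg : g ∈ classR) {i : ℕ} {α : ℝ} (hα : (i : ℝ) < α)
    (h : Tendsto (fun x : ℝ => x * deriv g x / g x) atTop (𝓝 α)) (j : ℕ) (hj : j ≤ i) :
    Tendsto (fun x : ℝ => x * iteratedDeriv (j + 1) g x / iteratedDeriv j g x)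
      atTop (𝓝 (α - j)) := by
  induction j with
  | zero => simpa using h
  | succ j ih =>
    have hji : (j : ℝ) + 1 ≤ i := by exact_mod_cast hj
    have := classR.index_step hg (by linarith) (ih (by omega))
    convert this using 2
    push_cast; ring

theorem eventually_pos_or_neg {f : ℝ → ℝ} (hc : ∀ᶠ x in atTop, ContinuousAt f x)
    (h0 : ∀ᶠ x in atTop, f x ≠ 0) :
    (∀ᶠ x in atTop, 0 < f x) ∨ ∀ᶠ x in atTop, f x < 0 := by
  obtain ⟨X, hX⟩ := eventually_atTop.1 (hc.and h0)
  have hcont : ContinuousOn f (Set.Ici X) := fun x hx => (hX x hx).1.continuousWithinAt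
  have key : ∀ x y, X ≤ x → X ≤ y → f x < 0 → 0 < f y → False := by
    intro x y hx hy h1 h2
    obtain ⟨z, hz, hz0⟩ := isPreconnected_Ici.intermediate_value hx hy hcont ⟨h1.le, h2.le⟩
    exact (hX z hz).2 hz0
  rcases lt_or_gt_of_ne (hX X le_rfl).2 with h | h
  · refine Or.inr (eventually_atTop.2 ⟨X, fun x hx => ?_⟩)
    exact lt_of_le_of_ne (not_lt.1 fun h' => key X x le_rfl hx h h') (hX x hx).2
  · refine Or.inl (eventually_atTop.2 ⟨X, fun x hx => ?_⟩)
    exact lt_of_le_of_ne (not_lt.1 fun h' => key x X hx le_rfl h' h) (hX x hx).2.symm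

theorem tempered_zero_of_deriv_neg {y y' : ℝ → ℝ} (hd : ∀ᶠ x in atTop, HasDerivAt y (y' x) x)
    (hneg : ∀ᶠ x in atTop, y' x < 0) (h0 : Tendsto y atTop (𝓝 0))
    (habs : Tendsto (fun x => |x * y x|) atTop atTop) : Tempered 0 y := by
  obtain ⟨X, hX⟩ := eventually_atTop.1 (hd.and hneg)
  have hanti : AntitoneOn y (Set.Ici X) :=
    antitoneOn_of_deriv_nonpos (convex_Ici X)
      (fun x hx => (hX x hx).1.continuousAt.continuousWithinAt)
      (fun x hx => (hX x (interior_subset hx)).1.differentiableAt.differentiableWithinAt)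
      fun x hx => by
        rw [(hX x (interior_subset hx)).1.deriv]; exact (hX x (interior_subset hx)).2.le
  refine ⟨⟨X, hanti⟩, h0, habs.congr' ?_⟩
  filter_upwards [eventually_ge_atTop X, eventually_ge_atTop 0] with x hx hx0
  refine abs_of_nonneg (mul_nonneg hx0 ?_)
  exact le_of_tendsto h0 (eventually_atTop.2 ⟨x, fun z hz => hanti hx (hx.trans hz) hz⟩)

/-- The i-th derivative has index α - i > 0, so it tends to ±∞, and x f^(i+1) is asymptotically (α -
i) times it. The next derivative is continuous and nonvanishing for large x, hence of constant sign,
so f^(i+1) tends to 0 monotonically; that sign selects f or -f. -/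
theorem classT.exists_tempered {f : ℝ → ℝ} (hf : f ∈ classT) :
    ∃ k, Tempered (k + 1) f ∨ Tempered (k + 1) (fun x => -f x) := by
  obtain ⟨i, hR, ⟨α, hα, -, hlim⟩, h0⟩ := Set.mem_iUnion.1 hf
  refine ⟨i, ?_⟩
  have hs := hR.1
  have hidx := classR.index_eq hR hα hlim i le_rfl
  have hpos : 0 < α - i := by linarith
  have hbig := tendsto_abs_atTop_of_logDeriv hpos (hs.hasDerivAt_iteratedDeriv i) (hR.2 i).1 hidx
  have habs : Tendsto (fun x => |x * iteratedDeriv (i + 1) f x|) atTop atTop := by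
    refine (hidx.abs.pos_mul_atTop (abs_pos.2 hpos.ne') hbig).congr' ?_
    filter_upwards [(hR.2 i).1] with x hx
    rw [← abs_mul, div_mul_cancel₀ _ hx]
  have hd := hs.hasDerivAt_iteratedDeriv
  rcases eventually_pos_or_neg ((hd (i + 2)).mono fun x h => h.continuousAt) (hR.2 (i + 2)).1
    with h | h
  · right
    have ht : Tempered 0 (fun x => -iteratedDeriv (i + 1) f x) :=
      tempered_zero_of_deriv_neg ((hd (i + 1)).mono fun x h => h.neg)
        (h.mono fun x hx => neg_lt_zero.2 hx) (by simpa using h0.neg)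
        (by simpa using habs)
    have := Tempered.of_chain (F := fun j x => -iteratedDeriv j f x)
      (fun j => (hd j).mono fun x h => h.neg) (i + 1) 0 (by simpa using ht)
    simpa using this
  · left
    have ht := tempered_zero_of_deriv_neg (hd (i + 1)) h h0 habs
    have := Tempered.of_chain (F := fun j => iteratedDeriv j f) hd (i + 1) 0 (by simpa using ht)
    simpa using this

theorem classT.cesaroZero {f : ℝ → ℝ} (hf : f ∈ classT) :
    CesaroZero (fun n => expChar (f n)) := by
  obtain ⟨k, h | h⟩ := classT.exists_tempered hf
  · exact h.cesaroZero
  · simpa [expChar_neg] using h.cesaroZero.conj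

/-! ### Fourier analysis and equidistribution on the torus -/

instance nullSingletonClass_haarAddCircle :
    NullSingletonClass (AddCircle.haarAddCircle (T := (1 : ℝ))) := by
  have : (𝓝[≠] (0 : AddCircle (1 : ℝ))).NeBot := by
    have h : Tendsto (fun x : ℝ => (x : AddCircle (1 : ℝ))) (𝓝[>] 0) (𝓝[≠] 0) := by
      refine tendsto_nhdsWithin_iff.2 ⟨?_, ?_⟩
      · have : Tendsto (fun x : ℝ => (x : AddCircle (1 : ℝ))) (𝓝 0) (𝓝 ((0 : ℝ) : AddCircle (1 : ℝ))) :=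
          (AddCircle.continuous_mk' 1).tendsto 0
        exact this.mono_left nhdsWithin_le_nhds
      · filter_upwards [Ioo_mem_nhdsGT (show (0 : ℝ) < 1 by norm_num)] with x hx h0
        obtain ⟨n, hn⟩ := (AddCircle.coe_eq_zero_iff (1 : ℝ)).1 h0
        rw [zsmul_eq_mul, mul_one] at hn
        have h1 := hx.1
        have h2 := hx.2
        rw [← hn] at h1 h2
        have h1' : 0 < n := by exact_mod_cast h1
        have h2' : n < 1 := by exact_mod_cast h2
        omega
    exact h.neBot
  infer_instance

/-- Normalised Haar measure on the torus. -/
noncomputable def torusHaar (ι : Type*) [Fintype ι] : Measure (UnitAddTorus ι) :=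
  Measure.pi fun _ => AddCircle.haarAddCircle

instance isProbabilityMeasure_torusHaar (ι : Type*) [Fintype ι] :
    IsProbabilityMeasure (torusHaar ι) := by
  unfold torusHaar; infer_instance

theorem integral_fourier_haar (n : ℤ) :
    ∫ x : AddCircle (1 : ℝ), fourier n x ∂AddCircle.haarAddCircle = if n = 0 then 1 else 0 := by
  split_ifs with h
  · simp [h]
  · exact integral_eq_zero_of_add_right_eq_neg (fourier_add_half_inv_index h one_pos)

variable {ι : Type*} [Fintype ι]

theorem integral_mFourier (k : ι → ℤ) :
    ∫ x, UnitAddTorus.mFourier k x ∂torusHaar ι = if k = 0 then 1 else 0 := by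
  have : ∫ x, UnitAddTorus.mFourier k x ∂torusHaar ι =
      ∏ i, ∫ x : AddCircle (1 : ℝ), fourier (k i) x ∂AddCircle.haarAddCircle :=
    integral_fintype_prod_eq_prod (fun i (x : AddCircle (1 : ℝ)) => (fourier (k i) x : ℂ))
  rw [this]
  simp_rw [integral_fourier_haar]
  split_ifs with h
  · simp [h]
  · obtain ⟨i, hi⟩ := Function.ne_iff.1 h
    exact Finset.prod_eq_zero (Finset.mem_univ i) (if_neg hi)

/-- The point of the torus represented by a real vector. -/
def toTorus (x : ι → ℝ) : UnitAddTorus ι := fun i => (x i : UnitAddCircle)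

theorem mFourier_toTorus (k : ι → ℤ) (t : ι → ℝ) :
    UnitAddTorus.mFourier k (toTorus t) = expChar (∑ i, k i * t i) := by
  simp only [toTorus, UnitAddTorus.mFourier, ContinuousMap.coe_mk, UnitAddCircle, fourier_coe_apply, expChar]
  rw [← Complex.exp_sum]
  congr 1
  push_cast
  rw [Finset.mul_sum, Finset.sum_mul]
  exact Finset.sum_congr rfl fun i _ => by ring

theorem CesaroZero.of_approx {u : ℕ → ℂ}
    (h : ∀ ε > 0, ∃ v, CesaroZero v ∧
      ∀ᶠ N : ℕ in atTop, (N : ℝ)⁻¹ * ∑ n ∈ Finset.range N, ‖u n - v n‖ ≤ ε) : CesaroZero u := by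
  rw [CesaroZero, Metric.tendsto_nhds]
  intro ε hε
  obtain ⟨v, hv, hb⟩ := h (ε / 2) (by positivity)
  rw [CesaroZero, Metric.tendsto_nhds] at hv
  filter_upwards [hv (ε / 2) (by positivity), hb] with N h1 h2
  rw [dist_zero_right] at h1 ⊢
  have e : (N : ℝ)⁻¹ • ∑ n ∈ Finset.range N, u n = (N : ℝ)⁻¹ • ∑ n ∈ Finset.range N, (u n - v n) +
      (N : ℝ)⁻¹ • ∑ n ∈ Finset.range N, v n := by
    rw [← smul_add, ← Finset.sum_add_distrib]; simp
  have h3 : ‖(N : ℝ)⁻¹ • ∑ n ∈ Finset.range N, (u n - v n)‖ ≤ ε / 2 := by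
    rw [norm_smul, Real.norm_of_nonneg (by positivity)]
    refine le_trans ?_ h2
    gcongr
    exact norm_sum_le _ _
  rw [e]
  linarith [norm_add_le ((N : ℝ)⁻¹ • ∑ n ∈ Finset.range N, (u n - v n))
    ((N : ℝ)⁻¹ • ∑ n ∈ Finset.range N, v n)]

/-- Uniformly bounded functionals averaging to zero on characters average to zero on all
continuous functions. -/
theorem cesaroZero_of_mFourier (Φ : ℕ → C(UnitAddTorus ι, ℂ) →ₗ[ℂ] ℂ) (C : ℝ)
    (hΦ : ∀ n H, ‖Φ n H‖ ≤ C * ‖H‖)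
    (hk : ∀ k, CesaroZero (fun n => Φ n (UnitAddTorus.mFourier k))) (H : C(UnitAddTorus ι, ℂ)) :
    CesaroZero (fun n => Φ n H) := by
  have hspan : ∀ P ∈ Submodule.span ℂ (Set.range (UnitAddTorus.mFourier (d := ι))),
      CesaroZero (fun n => Φ n P) := by
    intro P hP
    induction hP using Submodule.span_induction with
    | mem x hx => obtain ⟨k, rfl⟩ := hx; exact hk k
    | zero => simp [CesaroZero]
    | add x y _ _ hx hy => simpa using hx.add hy
    | smul a x _ hx => simpa using hx.const_mul a
  refine CesaroZero.of_approx fun ε hε => ?_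
  have hH : H ∈ (Submodule.span ℂ
      (Set.range (UnitAddTorus.mFourier (d := ι)))).topologicalClosure := by
    rw [UnitAddTorus.span_mFourier_closure_eq_top]; trivial
  obtain ⟨P, hP, hd⟩ := Metric.mem_closure_iff.1 hH (ε / (|C| + 1)) (by positivity)
  refine ⟨_, hspan P hP, ?_⟩
  filter_upwards [eventually_gt_atTop 0] with N hN
  have hN' : (0 : ℝ) < N := by exact_mod_cast hN
  have hb : ∀ n, ‖Φ n H - Φ n P‖ ≤ ε := by
    intro n
    rw [← map_sub]
    rw [dist_eq_norm, lt_div_iff₀ (by positivity)] at hd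
    have h1 : C * ‖H - P‖ ≤ |C| * ‖H - P‖ := by gcongr; exact le_abs_self C
    have := hΦ n (H - P)
    have := norm_nonneg (H - P)
    nlinarith
  calc _ ≤ (N : ℝ)⁻¹ * ∑ n ∈ Finset.range N, ε := by gcongr; exact hb _
    _ = ε := by simp; field_simp

section Equidistribution

variable {G : ℕ → ι → ℝ}
  (hG : ∀ c : ι → ℝ, c ≠ 0 → CesaroZero (fun n => expChar (∑ i, c i * G n i)))

include hG

/-- On a character of frequency k the twist only shifts the frequency to t + k, which is nonzero
because t is not an integer vector. -/
theorem cesaroZero_twisted {t : ι → ℝ} (ht : ∀ k : ι → ℤ, (fun i => t i + k i) ≠ 0)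
    (H : C(UnitAddTorus ι, ℂ)) :
    CesaroZero (fun n => expChar (∑ i, t i * G n i) * H (toTorus (G n))) := by
  refine cesaroZero_of_mFourier (fun n =>
    { toFun := fun H => expChar (∑ i, t i * G n i) * H (toTorus (G n))
      map_add' := fun _ _ => by simp [mul_add]
      map_smul' := fun _ _ => by simp; ring }) 1 ?_ ?_ H
  · intro n H
    simp only [LinearMap.coe_mk, AddHom.coe_mk, norm_mul, norm_expChar]
    exact mul_le_mul_of_nonneg_left (H.norm_coe_le_norm _) zero_le_one
  · intro k
    refine (hG _ (ht k)).congr' (.of_forall fun N => ?_)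
    congr 1
    refine Finset.sum_congr rfl fun n _ => ?_
    simp only [LinearMap.coe_mk, AddHom.coe_mk, mFourier_toTorus]
    rw [← expChar_add, ← Finset.sum_add_distrib]
    simp only [add_mul]

theorem equidistributed (H : C(UnitAddTorus ι, ℂ)) :
    CesaroZero (fun n => H (toTorus (G n)) - ∫ x, H x ∂torusHaar ι) := by
  have hint : ∀ H : C(UnitAddTorus ι, ℂ), Integrable H (torusHaar ι) := fun H =>
    H.continuous.integrable_of_hasCompactSupport (HasCompactSupport.of_compactSpace H)
  refine cesaroZero_of_mFourier (fun n =>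
    { toFun := fun H => H (toTorus (G n)) - ∫ x, H x ∂torusHaar ι
      map_add' := fun H K => by
        have := integral_add (hint H) (hint K)
        simp only [ContinuousMap.add_apply, this]; ring
      map_smul' := fun a H => by
        simp only [ContinuousMap.smul_apply, integral_smul, RingHom.id_apply, smul_sub] }) 2 ?_ ?_ H
  · intro n H
    simp only [LinearMap.coe_mk, AddHom.coe_mk]
    have h1 : ‖∫ x, H x ∂torusHaar ι‖ ≤ ‖H‖ := by
      simpa using norm_integral_le_of_norm_le_const (μ := torusHaar ι)
        (.of_forall fun x => H.norm_coe_le_norm x)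
    linarith [norm_sub_le (H (toTorus (G n))) (∫ x, H x ∂torusHaar ι),
      H.norm_coe_le_norm (toTorus (G n))]
  · intro k
    simp only [LinearMap.coe_mk, AddHom.coe_mk, integral_mFourier]
    split_ifs with h
    · simp [h, UnitAddTorus.mFourier_zero, CesaroZero]
    · have := hG (fun i => (k i : ℝ)) (by
        obtain ⟨i, hi⟩ := Function.ne_iff.1 h
        exact Function.ne_iff.2 ⟨i, by simpa using hi⟩)
      simpa [mFourier_toTorus] using this

end Equidistribution

/-! ### Passage to integer parts -/

/-- The factor `exp (-2πi t {x})` correcting `exp (2πi t x)` to `exp (2πi t ⌊x⌋)`. -/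
noncomputable def fractFactor (t : ℝ) (x : AddCircle (1 : ℝ)) : ℂ :=
  expChar (-(t * (AddCircle.equivIco 1 0 x : ℝ)))

theorem fractFactor_coe (t x : ℝ) : expChar (t * x) * fractFactor t x = expChar (t * ⌊x⌋) := by
  rw [fractFactor, AddCircle.coe_equivIco_mk_apply, ← expChar_add]
  congr 1
  rw [div_one, mul_one, Int.fract]; ring

/-- A continuous cutoff on the circle vanishing at the origin. -/
noncomputable def cutoff (m : ℕ) (x : AddCircle (1 : ℝ)) : ℝ := min 1 (m * ‖x‖)

theorem continuous_cutoff (m : ℕ) : Continuous (cutoff m) := by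
  unfold cutoff; fun_prop

theorem cutoff_nonneg (m : ℕ) (x : AddCircle (1 : ℝ)) : 0 ≤ cutoff m x :=
  le_min zero_le_one (by positivity)

theorem cutoff_le_one (m : ℕ) (x : AddCircle (1 : ℝ)) : cutoff m x ≤ 1 := min_le_left _ _

theorem tendsto_cutoff {x : AddCircle (1 : ℝ)} (hx : x ≠ 0) :
    Tendsto (fun m => cutoff m x) atTop (𝓝 1) := by
  refine tendsto_const_nhds.congr' ?_
  have := tendsto_natCast_atTop_atTop.atTop_mul_const (norm_pos_iff.2 hx)
  filter_upwards [this.eventually_ge_atTop 1] with m hm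
  exact (min_eq_left hm).symm

theorem continuous_expChar : Continuous expChar := by
  unfold expChar; fun_prop

/-- The fractional part jumps only at the origin, where the cutoff vanishes and the other factor
stays bounded. -/
theorem continuous_fractFactor_mul_cutoff (t : ℝ) (m : ℕ) :
    Continuous fun x => fractFactor t x * (cutoff m x : ℂ) := by
  rw [continuous_iff_continuousAt]
  intro x
  have hc : ContinuousAt (fun x => (cutoff m x : ℂ)) x :=
    (Complex.continuous_ofReal.comp (continuous_cutoff m)).continuousAt
  by_cases hx : x = 0
  · subst hx
    have h0 : (cutoff m 0 : ℂ) = 0 := by simp [cutoff]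
    rw [ContinuousAt, h0] at hc
    rw [ContinuousAt, h0, mul_zero]
    refine squeeze_zero_norm (fun x => ?_) (by simpa only [norm_zero] using hc.norm)
    rw [norm_mul, fractFactor, norm_expChar, one_mul]
  · refine ContinuousAt.mul ?_ hc
    have h1 : ContinuousAt (fun x => (AddCircle.equivIco (1 : ℝ) 0 x : ℝ)) x :=
      continuous_subtype_val.continuousAt.comp (AddCircle.continuousAt_equivIco (1 : ℝ) 0 (by simpa using hx))
    exact continuous_expChar.continuousAt.comp (continuousAt_const.mul h1).neg

theorem tendsto_integral_cutoff :
    Tendsto (fun m => ∫ x, (∏ i, (cutoff m (x i) : ℂ)) ∂torusHaar ι) atTop (𝓝 1) := by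
  have h1 : (1 : ℂ) = ∫ x, (1 : ℂ) ∂torusHaar ι := by simp
  rw [h1]
  refine tendsto_integral_of_dominated_convergence (fun _ => 1) ?_ (integrable_const _) ?_ ?_
  · intro m
    refine Continuous.aestronglyMeasurable ?_
    exact continuous_finsetProd _ fun i _ =>
      Complex.continuous_ofReal.comp ((continuous_cutoff m).comp (continuous_apply i))
  · intro m
    refine .of_forall fun x => ?_
    rw [norm_prod]
    refine Finset.prod_le_one (fun i _ => norm_nonneg _) fun i _ => ?_
    rw [Complex.norm_real, Real.norm_of_nonneg (cutoff_nonneg _ _)]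
    exact cutoff_le_one _ _
  · have : ∀ᵐ x ∂torusHaar ι, ∀ i, x i ≠ 0 :=
      ae_all_iff.2 fun i => Measure.ae_eval_ne (fun _ => AddCircle.haarAddCircle) i 0
    filter_upwards [this] with x hx
    have h := tendsto_finsetProd (Finset.univ : Finset ι) fun i _ =>
      (Complex.continuous_ofReal.tendsto 1).comp (tendsto_cutoff (hx i))
    simpa using h

/-- Integer parts of an equidistributed vector form an ergodic sequence in `ℤ^ι`. -/
theorem cesaroZero_floor {G : ℕ → ι → ℝ}
    (hG : ∀ c : ι → ℝ, c ≠ 0 → CesaroZero (fun n => expChar (∑ i, c i * G n i)))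
    {θ : UnitAddTorus ι} (hθ : θ ≠ 0) :
    CesaroZero (fun n => UnitAddTorus.mFourier (fun i => ⌊G n i⌋) θ) := by
  obtain ⟨t, rfl⟩ : ∃ t : ι → ℝ, θ = toTorus t := by
    choose t ht using fun i => QuotientAddGroup.mk_surjective (θ i)
    exact ⟨t, funext fun i => (ht i).symm⟩
  -- A nonzero point of the torus is represented by a non-integral vector.
  have ht : ∀ k : ι → ℤ, (fun i => t i + k i) ≠ 0 := by
    intro k hk
    refine hθ (funext fun i => ?_)
    refine (AddCircle.coe_eq_zero_iff (1 : ℝ)).2 ⟨-k i, ?_⟩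
    have := congrFun hk i
    simp only [Pi.zero_apply] at this
    simp; linarith
  have hu : ∀ n, UnitAddTorus.mFourier (fun i => ⌊G n i⌋) (toTorus t) =
      expChar (∑ i, t i * G n i) * ∏ i, fractFactor (t i) (toTorus (G n) i) := by
    have hexp : ∀ f : ι → ℝ, expChar (∑ i, f i) = ∏ i, expChar (f i) := by
      intro f
      simp only [expChar]
      rw [← Complex.exp_sum]
      congr 1
      push_cast
      rw [Finset.mul_sum, Finset.sum_mul]
    intro n
    rw [mFourier_toTorus, hexp, hexp, ← Finset.prod_mul_distrib]
    refine Finset.prod_congr rfl fun i _ => ?_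
    rw [toTorus, fractFactor_coe, mul_comm]
  simp only [hu]
  refine CesaroZero.of_approx fun ε hε => ?_
  have hev := (tendsto_integral_cutoff (ι := ι)).eventually (Metric.ball_mem_nhds 1 (half_pos hε))
  obtain ⟨m, hm⟩ := hev.exists
  rw [dist_eq_norm] at hm
  let H : C(UnitAddTorus ι, ℂ) := ⟨fun x => ∏ i, (fractFactor (t i) (x i) * (cutoff m (x i) : ℂ)),
    continuous_finsetProd _ fun i _ =>
      (continuous_fractFactor_mul_cutoff (t i) m).comp (continuous_apply i)⟩
  let W : C(UnitAddTorus ι, ℂ) := ⟨fun x => ∏ i, (cutoff m (x i) : ℂ),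
    continuous_finsetProd _ fun i _ =>
      Complex.continuous_ofReal.comp ((continuous_cutoff m).comp (continuous_apply i))⟩
  refine ⟨_, cesaroZero_twisted hG ht H, ?_⟩
  have hW := (equidistributed hG W).norm
  rw [norm_zero] at hW
  filter_upwards [hW.eventually_lt_const (half_pos hε), eventually_gt_atTop 0] with N hN hN0
  have hN' : (0 : ℝ) < N := by exact_mod_cast hN0
  set w : UnitAddTorus ι → ℝ := fun x => ∏ i, cutoff m (x i) with hw
  have hw1 : ∀ x, w x ≤ 1 := fun x =>
    Finset.prod_le_one (fun i _ => cutoff_nonneg _ _) fun i _ => cutoff_le_one _ _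
  have hWw : ∀ x, W x = (w x : ℂ) := fun x => by simp [W, hw]
  -- The error of the cutoff is exactly 1 - w; by equidistribution its average approaches 1 - ∫ w,
  -- small by the choice of `m`.
  have hdiff : ∀ n, ‖expChar (∑ i, t i * G n i) * ∏ i, fractFactor (t i) (toTorus (G n) i) -
      expChar (∑ i, t i * G n i) * H (toTorus (G n))‖ = 1 - w (toTorus (G n)) := by
    intro n
    have hH : H (toTorus (G n)) =
        (∏ i, fractFactor (t i) (toTorus (G n) i)) * (w (toTorus (G n)) : ℂ) := by
      simp [H, hw, Finset.prod_mul_distrib]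
    have e : ∀ a b c : ℂ, a * b - a * (b * c) = a * (b * (1 - c)) := fun a b c => by ring
    rw [hH, e, norm_mul, norm_mul, norm_expChar, norm_prod]
    simp only [fractFactor, norm_expChar, Finset.prod_const_one, one_mul]
    rw [← Complex.ofReal_one, ← Complex.ofReal_sub, Complex.norm_real,
      Real.norm_of_nonneg (sub_nonneg.2 (hw1 _))]
  simp only [hdiff]
  have hfin : (((N : ℝ)⁻¹ * ∑ n ∈ Finset.range N, (1 - w (toTorus (G n))) : ℝ) : ℂ) =
      -((N : ℝ)⁻¹ • ∑ n ∈ Finset.range N, (W (toTorus (G n)) - ∫ x, W x ∂torusHaar ι)) -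
        (∫ x, W x ∂torusHaar ι - 1) := by
    have hN2 : (N : ℂ) ≠ 0 := by exact_mod_cast hN0.ne'
    simp only [hWw, Finset.sum_sub_distrib, Complex.real_smul]
    push_cast
    simp only [Finset.sum_const, Finset.card_range, nsmul_eq_mul]
    field_simp
    ring
  have hle : (N : ℝ)⁻¹ * ∑ n ∈ Finset.range N, (1 - w (toTorus (G n))) ≤
      ‖(((N : ℝ)⁻¹ * ∑ n ∈ Finset.range N, (1 - w (toTorus (G n))) : ℝ) : ℂ)‖ := by
    rw [Complex.norm_real]; exact le_abs_self _
  refine hle.trans ?_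
  rw [hfin]
  refine (norm_sub_le _ _).trans ?_
  rw [norm_neg]
  have : ‖∫ x, W x ∂torusHaar ι - 1‖ < ε / 2 := hm
  linarith

/-! ### Spectral measures of finite sets -/

theorem integrable_mFourier (k : ι → ℤ) : Integrable (UnitAddTorus.mFourier k) (torusHaar ι) :=
  (ContinuousMap.continuous _).integrable_of_hasCompactSupport (HasCompactSupport.of_compactSpace _)

theorem norm_sq_sum_mFourier {κ : Type*} (s : Finset κ) (w : κ → ι → ℤ) (x : UnitAddTorus ι) :
    ((‖∑ k ∈ s, UnitAddTorus.mFourier (w k) x‖ ^ 2 : ℝ) : ℂ) =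
      ∑ k ∈ s, ∑ k' ∈ s, UnitAddTorus.mFourier (w k - w k') x := by
  rw [← Complex.normSq_eq_norm_sq, ← Complex.mul_conj, map_sum, Finset.sum_mul_sum]
  simp only [sub_eq_add_neg, UnitAddTorus.mFourier_add, UnitAddTorus.mFourier_neg]

theorem continuous_norm_sq_sum_mFourier {κ : Type*} (s : Finset κ) (w : κ → ι → ℤ) :
    Continuous fun x => ‖∑ k ∈ s, UnitAddTorus.mFourier (w k) x‖ ^ 2 := by
  fun_prop

/-- By orthogonality the integral is the sum over z ∈ S of the squared number of representations z =
w k; apply Cauchy–Schwarz over `S`. -/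
theorem sq_card_le_integral {κ : Type*} (s : Finset κ) (w : κ → ι → ℤ) (S : Finset (ι → ℤ))
    (hS : ∀ k ∈ s, w k ∈ S) :
    (s.card : ℝ) ^ 2 ≤
      S.card * ∫ x, ‖∑ k ∈ s, UnitAddTorus.mFourier (w k) x‖ ^ 2 ∂torusHaar ι := by
  classical
  have hint : ((∫ x, ‖∑ k ∈ s, UnitAddTorus.mFourier (w k) x‖ ^ 2 ∂torusHaar ι : ℝ) : ℂ) =
      ((∑ z ∈ S, ((s.filter fun k => w k = z).card : ℝ) ^ 2 : ℝ) : ℂ) := by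
    rw [← integral_complex_ofReal]
    simp only [norm_sq_sum_mFourier]
    rw [integral_finsetSum _ fun k _ => integrable_finsetSum _ fun k' _ => integrable_mFourier _]
    simp_rw [integral_finsetSum _ fun k' _ => integrable_mFourier _, integral_mFourier]
    have h1 : ∀ k ∈ s, ∑ k' ∈ s, (if w k - w k' = 0 then (1 : ℂ) else 0) =
        ((s.filter fun k' => w k' = w k).card : ℂ) := by
      intro k _
      simp [sub_eq_zero, eq_comm]
    rw [Finset.sum_congr rfl h1, ← Finset.sum_fiberwise_of_maps_to hS]
    push_cast
    refine Finset.sum_congr rfl fun z _ => ?_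
    rw [Finset.sum_congr rfl (g := fun _ => ((s.filter fun k' => w k' = z).card : ℂ))]
    · simp [sq]
    · intro k hk
      rw [(Finset.mem_filter.1 hk).2]
  rw [Complex.ofReal_inj.1 hint]
  have hc : (s.card : ℝ) = ∑ z ∈ S, ((s.filter fun k => w k = z).card : ℝ) := by
    exact_mod_cast Finset.card_eq_sum_card_fiberwise hS
  rw [hc]
  exact sq_sum_le_card_mul_sum_sq

/-- The spectral measure of a finite set `A`, with density `|∑_{k ∈ A} e(k · x)|² / |A|`. -/
noncomputable def specMeasure (A : Finset (ι → ℤ)) : Measure (UnitAddTorus ι) :=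
  (torusHaar ι).withDensity fun x =>
    ENNReal.ofReal (‖∑ k ∈ A, UnitAddTorus.mFourier k x‖ ^ 2 / A.card)

theorem integral_specMeasure {F : Type*} [NormedAddCommGroup F] [NormedSpace ℝ F]
    (A : Finset (ι → ℤ)) (g : UnitAddTorus ι → F) :
    ∫ x, g x ∂specMeasure A =
      ∫ x, (‖∑ k ∈ A, UnitAddTorus.mFourier k x‖ ^ 2 / A.card) • g x ∂torusHaar ι := by
  rw [specMeasure, integral_withDensity_eq_integral_toReal_smul]
  · congr 1
    ext x
    rw [ENNReal.toReal_ofReal (by positivity)]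
  · exact (((continuous_norm_sq_sum_mFourier A id).div_const _).measurable).ennreal_ofReal
  · simp

theorem integral_mFourier_specMeasure (A : Finset (ι → ℤ)) (v : ι → ℤ) :
    ∫ x, UnitAddTorus.mFourier v x ∂specMeasure A =
      (((A.filter fun y => y + v ∈ A).card / A.card : ℝ) : ℂ) := by
  rw [integral_specMeasure]
  have h : ∀ x, (‖∑ k ∈ A, UnitAddTorus.mFourier k x‖ ^ 2 / A.card : ℝ) •
      UnitAddTorus.mFourier v x = (A.card : ℂ)⁻¹ * ∑ y ∈ A, ∑ z ∈ A,
        UnitAddTorus.mFourier (y - z + v) x := by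
    intro x
    rw [Complex.real_smul, Complex.ofReal_div, norm_sq_sum_mFourier A (fun k => k)]
    simp only [UnitAddTorus.mFourier_add, ← Finset.sum_mul]
    push_cast
    ring
  simp only [h]
  rw [integral_const_mul,
    integral_finsetSum _ fun k _ => integrable_finsetSum _ fun k' _ => integrable_mFourier _]
  simp_rw [integral_finsetSum _ fun k' _ => integrable_mFourier _, integral_mFourier]
  have h1 : ∀ y ∈ A, ∑ z ∈ A, (if y - z + v = 0 then (1 : ℂ) else 0) =
      if y + v ∈ A then 1 else 0 := by
    intro y _
    have : ∀ z, (y - z + v = 0) ↔ y + v = z := fun z => by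
      rw [← sub_eq_zero (a := y + v)]; constructor <;> intro h <;> rw [← h] <;> abel
    simp only [this, Finset.sum_ite_eq]
  rw [Finset.sum_congr rfl h1]
  simp only [Finset.sum_boole]
  push_cast
  ring

theorem isProbabilityMeasure_specMeasure {A : Finset (ι → ℤ)} (hA : A.Nonempty) :
    IsProbabilityMeasure (specMeasure A) := by
  have hfin : IsFiniteMeasure (specMeasure A) := by
    refine isFiniteMeasure_withDensity_ofReal ?_
    exact ((continuous_norm_sq_sum_mFourier A id).div_const _).integrable_of_hasCompactSupport
      (HasCompactSupport.of_compactSpace _) |>.2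
  have h := integral_mFourier_specMeasure A 0
  have hc : (A.card : ℝ) ≠ 0 := by exact_mod_cast hA.card_pos.ne'
  simp only [UnitAddTorus.mFourier_zero, ContinuousMap.one_apply, add_zero, integral_const] at h
  rw [Finset.filter_true_of_mem (fun _ h => h), div_self hc] at h
  constructor
  have h' : (specMeasure A).real Set.univ = 1 := by simpa using h
  rwa [measureReal_def, ENNReal.toReal_eq_one_iff] at h'

/-- The exponential sum over all pairs v n + y factors into the sum over n and the sum over `A`; the
latter is absorbed in the density of the measure. If the translates of `A` fit in a set `S` not much
larger than `A`, the averages cannot be small in mean square. -/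
theorem sq_card_le_integral_specMeasure (A : Finset (ι → ℤ)) (hA : A.Nonempty) (v : ℕ → ι → ℤ)
    (N : ℕ) (S : Finset (ι → ℤ)) (hS : ∀ n < N, ∀ y ∈ A, v n + y ∈ S) :
    (N : ℝ) ^ 2 * A.card ≤ S.card *
      ∫ x, ‖∑ n ∈ Finset.range N, UnitAddTorus.mFourier (v n) x‖ ^ 2 ∂specMeasure A := by
  have h := sq_card_le_integral (Finset.range N ×ˢ A) (fun p => v p.1 + p.2) S (by
    intro p hp
    rw [Finset.mem_product, Finset.mem_range] at hp
    exact hS _ hp.1 _ hp.2)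
  have hc : (0 : ℝ) < A.card := by exact_mod_cast hA.card_pos
  rw [integral_specMeasure]
  have e : ∀ x, ‖∑ p ∈ Finset.range N ×ˢ A, UnitAddTorus.mFourier (v p.1 + p.2) x‖ ^ 2 =
      A.card * ((‖∑ k ∈ A, UnitAddTorus.mFourier k x‖ ^ 2 / A.card) •
        ‖∑ n ∈ Finset.range N, UnitAddTorus.mFourier (v n) x‖ ^ 2) := by
    intro x
    simp only [UnitAddTorus.mFourier_add]
    rw [Finset.sum_product]
    dsimp only
    rw [← Finset.sum_mul_sum, norm_mul, smul_eq_mul]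
    field_simp
  simp only [e, integral_const_mul] at h
  rw [Finset.card_product, Finset.card_range] at h
  push_cast at h
  have := le_of_mul_le_mul_right (a := (A.card : ℝ)) (b := (N : ℝ) ^ 2 * A.card)
    (c := S.card * ∫ x, (‖∑ k ∈ A, UnitAddTorus.mFourier k x‖ ^ 2 / A.card) •
        ‖∑ n ∈ Finset.range N, UnitAddTorus.mFourier (v n) x‖ ^ 2 ∂torusHaar ι)
    (by linarith) hc
  exact this

/-! ### Upper Banach density and the correspondence principle -/

section Density

variable {ℓ : ℕ}

/-- The proportion of a box occupied by a set. -/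
noncomputable def boxDensity (E : Set (Fin ℓ → ℤ)) (a b : Fin ℓ → ℤ) : ℝ :=
  ((E ∩ Set.Icc a b).ncard : ℝ) / ((Set.Icc a b).ncard : ℝ)

theorem boxDensity_nonneg (E : Set (Fin ℓ → ℤ)) (a b : Fin ℓ → ℤ) : 0 ≤ boxDensity E a b := by
  unfold boxDensity; positivity

theorem boxDensity_le_one (E : Set (Fin ℓ → ℤ)) (a b : Fin ℓ → ℤ) : boxDensity E a b ≤ 1 := by
  refine div_le_one_of_le₀ ?_ (by positivity)
  exact_mod_cast Set.ncard_le_ncard Set.inter_subset_right (Set.finite_Icc a b)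

theorem isBoundedUnder_boxDensity (E : Set (Fin ℓ → ℤ)) (a b : ℕ → Fin ℓ → ℤ) (f : Filter ℕ) :
    IsBoundedUnder (· ≤ ·) f fun n => boxDensity E (a n) (b n) :=
  isBoundedUnder_of ⟨1, fun _ => boxDensity_le_one _ _ _⟩

theorem isCoboundedUnder_boxDensity (E : Set (Fin ℓ → ℤ)) (a b : ℕ → Fin ℓ → ℤ) :
    IsCoboundedUnder (· ≤ ·) atTop fun n => boxDensity E (a n) (b n) :=
  (isBoundedUnder_of (r := (· ≥ ·)) ⟨0, fun _ => boxDensity_nonneg _ _ _⟩).isCoboundedUnder_le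

theorem limsup_boxDensity_mem (E : Set (Fin ℓ → ℤ)) (a b : ℕ → Fin ℓ → ℤ) :
    limsup (fun n => boxDensity E (a n) (b n)) atTop ∈ Set.Icc (0 : ℝ) 1 :=
  ⟨le_limsup_of_frequently_le (Frequently.of_forall fun _ => boxDensity_nonneg _ _ _)
      (isBoundedUnder_boxDensity _ _ _ _),
    limsup_le_of_le (isCoboundedUnder_boxDensity _ _ _) (.of_forall fun _ => boxDensity_le_one _ _ _)⟩

theorem limsup_le_upperBanachDensity (E : Set (Fin ℓ → ℤ)) {a b : ℕ → Fin ℓ → ℤ}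
    (hab : ∀ n, a n ≤ b n) (ht : ∀ i, Tendsto (fun n => b n i - a n i) atTop atTop) :
    limsup (fun n => boxDensity E (a n) (b n)) atTop ≤ upperBanachDensity E := by
  refine le_csSup ⟨1, ?_⟩ ⟨a, b, hab, ht, rfl⟩
  rintro _ ⟨a, b, -, -, rfl⟩
  exact (limsup_boxDensity_mem E a b).2

theorem upperBanachDensity_nonneg (E : Set (Fin ℓ → ℤ)) : 0 ≤ upperBanachDensity E := by
  refine Real.sSup_nonneg ?_
  rintro _ ⟨a, b, -, -, rfl⟩
  exact (limsup_boxDensity_mem E a b).1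

theorem upperBanachDensity_le_one (E : Set (Fin ℓ → ℤ)) : upperBanachDensity E ≤ 1 := by
  refine Real.sSup_le ?_ zero_le_one
  rintro _ ⟨a, b, -, -, rfl⟩
  exact (limsup_boxDensity_mem E a b).2

theorem exists_boxes_of_lt_upperBanachDensity {E : Set (Fin ℓ → ℤ)} {c : ℝ} (hc0 : 0 ≤ c)
    (hc : c < upperBanachDensity E) : ∃ a b : ℕ → Fin ℓ → ℤ, (∀ n, a n ≤ b n) ∧
      (∀ i, Tendsto (fun n => b n i - a n i) atTop atTop) ∧
      ∃ᶠ n in atTop, c < boxDensity E (a n) (b n) := by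
  -- The supremum of an empty set of reals is 0 by convention, which 0 ≤ c < d*(E) excludes.
  have hne : {d : ℝ | ∃ a b : ℕ → Fin ℓ → ℤ, (∀ n, a n ≤ b n) ∧
      (∀ i, Tendsto (fun n => b n i - a n i) atTop atTop) ∧
      d = limsup (fun n => ((E ∩ Set.Icc (a n) (b n)).ncard : ℝ) /
        ((Set.Icc (a n) (b n)).ncard : ℝ)) atTop}.Nonempty := by
    rw [Set.nonempty_iff_ne_empty]
    intro h
    rw [upperBanachDensity, h, Real.sSup_empty] at hc
    linarith
  obtain ⟨_, ⟨a, b, hab, ht, rfl⟩, hlt⟩ := exists_lt_of_lt_csSup hne hc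
  exact ⟨a, b, hab, ht, frequently_lt_of_lt_limsup (isCoboundedUnder_boxDensity E a b) hlt⟩

theorem tendsto_card_box_ratio {a b : ℕ → Fin ℓ → ℤ} (hab : ∀ n, a n ≤ b n)
    (ht : ∀ i, Tendsto (fun n => b n i - a n i) atTop atTop) (R : ℕ) :
    Tendsto (fun n => ((Finset.Icc (a n - fun _ => (R : ℤ)) (b n + fun _ => (R : ℤ))).card : ℝ) /
      (Finset.Icc (a n) (b n)).card) atTop (𝓝 1) := by
  have h1 : ∀ n, ((Finset.Icc (a n - fun _ => (R : ℤ)) (b n + fun _ => (R : ℤ))).card : ℝ) /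
      (Finset.Icc (a n) (b n)).card =
      ∏ i, (1 + 2 * R * (((b n i - a n i : ℤ) : ℝ) + 1)⁻¹) := by
    intro n
    rw [Pi.card_Icc, Pi.card_Icc]
    push_cast
    rw [← Finset.prod_div_distrib]
    refine Finset.prod_congr rfl fun i _ => ?_
    have hi : a n i ≤ b n i := hab n i
    have e1 : ((Finset.Icc (a n i) (b n i)).card : ℝ) = ((b n i - a n i : ℤ) : ℝ) + 1 := by
      rw [Int.card_Icc, ← Int.cast_natCast (R := ℝ), Int.toNat_of_nonneg (by omega)]
      push_cast; ring
    have e2 : ((Finset.Icc ((a n - fun _ => (R : ℤ) : Fin ℓ → ℤ) i)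
        ((b n + fun _ => (R : ℤ) : Fin ℓ → ℤ) i)).card : ℝ) =
        ((b n i - a n i : ℤ) : ℝ) + 1 + 2 * R := by
      simp only [Pi.sub_apply, Pi.add_apply]
      rw [Int.card_Icc, ← Int.cast_natCast (R := ℝ), Int.toNat_of_nonneg (by omega)]
      push_cast; ring
    rw [e1, e2]
    have : (0 : ℝ) < ((b n i - a n i : ℤ) : ℝ) + 1 := by
      have : (0 : ℤ) ≤ b n i - a n i := by omega
      have : (0 : ℝ) ≤ ((b n i - a n i : ℤ) : ℝ) := by exact_mod_cast this
      linarith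
    rw [add_div, div_self this.ne', div_eq_mul_inv]
    push_cast
    rfl
  simp only [h1]
  have h2 := tendsto_finsetProd (Finset.univ : Finset (Fin ℓ)) fun i _ =>
    ((tendsto_inv_atTop_zero.comp (tendsto_atTop_add_const_right _ (1 : ℝ)
      (tendsto_intCast_atTop_atTop (R := ℝ) |>.comp (ht i)))).const_mul (2 * (R : ℝ))).const_add 1
  simpa using h2

/-- A Furstenberg-type correspondence: a spectral measure recording lower bounds for the densities of
the intersections `E ∩ (E - v)`. -/
theorem exists_spectral_measure {E : Set (Fin ℓ → ℤ)} {c : ℝ} (hc0 : 0 ≤ c)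
    (hc : c < upperBanachDensity E) :
    ∃ ν : Measure (UnitAddTorus (Fin ℓ)), IsProbabilityMeasure ν ∧
      (∀ v, c * (∫ x, UnitAddTorus.mFourier v x ∂ν).re ≤
        upperBanachDensity (E ∩ {x | x + v ∈ E})) ∧
      ∀ (v : ℕ → Fin ℓ → ℤ) (N : ℕ), c * (N : ℝ) ^ 2 ≤
        ∫ x, ‖∑ n ∈ Finset.range N, UnitAddTorus.mFourier (v n) x‖ ^ 2 ∂ν := by
  classical
  obtain ⟨a, b, hab, ht, hfreq⟩ := exists_boxes_of_lt_upperBanachDensity hc0 hc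
  set A : ℕ → Finset (Fin ℓ → ℤ) := fun n => (Finset.Icc (a n) (b n)).filter (· ∈ E) with hA
  have hIcc : ∀ n, (Set.Icc (a n) (b n)).ncard = (Finset.Icc (a n) (b n)).card := fun n => by
    rw [← Finset.coe_Icc, Set.ncard_coe_finset]
  have hIpos : ∀ n, (0 : ℝ) < (Finset.Icc (a n) (b n)).card := fun n => by
    exact_mod_cast (Finset.nonempty_Icc.2 (hab n)).card_pos
  have hAd : ∀ n, boxDensity E (a n) (b n) = (A n).card / (Finset.Icc (a n) (b n)).card := by
    intro n
    rw [boxDensity, hIcc]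
    congr 2
    rw [← Set.ncard_coe_finset]
    congr 1
    ext x; simp [hA, and_comm]
  have hne : (atTop ⊓ 𝓟 {n | c < boxDensity E (a n) (b n)}).NeBot := frequently_mem_iff_neBot.1 hfreq
  -- Density above `c` is only known for infinitely many boxes; an ultrafilter concentrated on them
  -- replaces passing to subsequences.
  set U : Ultrafilter ℕ := Ultrafilter.of (atTop ⊓ 𝓟 {n | c < boxDensity E (a n) (b n)})
  have hU : (U : Filter ℕ) ≤ atTop := (Ultrafilter.of_le _).trans inf_le_left
  have hUc : ∀ᶠ n in (U : Filter ℕ), c < boxDensity E (a n) (b n) :=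
    (Ultrafilter.of_le (atTop ⊓ 𝓟 {n | c < boxDensity E (a n) (b n)})).trans inf_le_right
      (mem_principal_self _)
  have hUne : ∀ᶠ n in (U : Filter ℕ), (A n).Nonempty := by
    filter_upwards [hUc] with n hn
    rw [hAd] at hn
    rw [Finset.nonempty_iff_ne_empty]
    intro h
    rw [h] at hn
    simp at hn; linarith
  -- Haar measure is a filler for empty `A n`, which does not occur along `U`.
  let ν' : ℕ → ProbabilityMeasure (UnitAddTorus (Fin ℓ)) := fun n =>
    if h : (A n).Nonempty then ⟨specMeasure (A n), isProbabilityMeasure_specMeasure h⟩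
    else ⟨torusHaar _, inferInstance⟩
  have hν' : ∀ n, (A n).Nonempty → (ν' n : Measure (UnitAddTorus (Fin ℓ))) = specMeasure (A n) :=
    fun n h => by simp [ν', h]
  obtain ⟨ν, -, hν⟩ := isCompact_univ.ultrafilter_le_nhds (U.map ν') (by simp)
  have hlim : Tendsto ν' U (𝓝 ν) := hν
  refine ⟨ν, inferInstance, fun v => ?_, fun v N => ?_⟩
  · have h1 := (ProbabilityMeasure.tendsto_iff_forall_integral_rclike_tendsto ℂ).1 hlim
      (BoundedContinuousFunction.mkOfCompact (UnitAddTorus.mFourier v))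
    simp only [BoundedContinuousFunction.mkOfCompact_apply] at h1
    have h2 := ((Complex.continuous_re.tendsto _).comp h1).const_mul c
    refine le_of_forall_gt_imp_ge_of_dense fun d hd => ?_
    refine le_of_tendsto h2 ?_
    have h3 := eventually_lt_of_limsup_lt
      ((limsup_le_upperBanachDensity (E ∩ {x | x + v ∈ E}) hab ht).trans_lt hd)
      (isBoundedUnder_boxDensity _ _ _ _)
    filter_upwards [hU h3, hUc, hUne] with n hn hcn hnen
    simp only [Function.comp_apply]
    rw [hν' n hnen, integral_mFourier_specMeasure, Complex.ofReal_re]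
    refine le_trans ?_ hn.le
    have hAp : (0 : ℝ) < (A n).card := by exact_mod_cast hnen.card_pos
    have hsub : (((A n).filter fun y => y + v ∈ A n).card : ℝ) ≤
        ((E ∩ {x | x + v ∈ E} ∩ Set.Icc (a n) (b n)).ncard : ℝ) := by
      rw [← Set.ncard_coe_finset]
      refine Nat.cast_le.2 (Set.ncard_le_ncard (fun y hy => ?_)
        ((Set.finite_Icc _ _).subset Set.inter_subset_right))
      obtain ⟨h1, h2⟩ := Finset.mem_filter.1 (Finset.mem_coe.1 hy)
      obtain ⟨h3, h4⟩ := Finset.mem_filter.1 h1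
      exact ⟨⟨h4, (Finset.mem_filter.1 h2).2⟩, Finset.mem_Icc.1 h3⟩
    calc c * ((((A n).filter fun y => y + v ∈ A n).card : ℝ) / (A n).card)
        ≤ ((A n).card / (Finset.Icc (a n) (b n)).card) *
          ((((A n).filter fun y => y + v ∈ A n).card : ℝ) / (A n).card) := by
          gcongr
          rw [← hAd]; exact hcn.le
      _ = (((A n).filter fun y => y + v ∈ A n).card : ℝ) / (Finset.Icc (a n) (b n)).card := by
          field_simp
      _ ≤ _ := by
          rw [boxDensity, hIcc]
          gcongr
  -- All sums v n + y with n < N lie in the box enlarged by `R`, whose cardinality is asymptotically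
  -- that of the original one.
  · obtain ⟨R, hR⟩ : ∃ R : ℕ, ∀ n < N, ∀ i, |v n i| ≤ R := by
      refine ⟨∑ n ∈ Finset.range N, ∑ i, (v n i).natAbs, fun n hn i => ?_⟩
      rw [Int.abs_eq_natAbs]
      have h1 : (v n i).natAbs ≤ ∑ i, (v n i).natAbs :=
        Finset.single_le_sum (f := fun i => (v n i).natAbs) (fun _ _ => Nat.zero_le _)
          (Finset.mem_univ i)
      have h2 : ∑ i, (v n i).natAbs ≤ ∑ n ∈ Finset.range N, ∑ i, (v n i).natAbs :=
        Finset.single_le_sum (f := fun n => ∑ i, (v n i).natAbs) (fun _ _ => Nat.zero_le _)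
          (Finset.mem_range.2 hn)
      exact_mod_cast h1.trans h2
    let Q : C(UnitAddTorus (Fin ℓ), ℝ) :=
      ⟨fun x => ‖∑ n ∈ Finset.range N, UnitAddTorus.mFourier (v n) x‖ ^ 2,
        continuous_norm_sq_sum_mFourier _ _⟩
    have h1 := ProbabilityMeasure.tendsto_iff_forall_integral_tendsto.1 hlim
      (BoundedContinuousFunction.mkOfCompact Q)
    simp only [BoundedContinuousFunction.mkOfCompact_apply] at h1
    have h2 := ((tendsto_card_box_ratio hab ht R).mono_left hU).mul h1
    rw [one_mul] at h2
    refine ge_of_tendsto h2 ?_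
    filter_upwards [hUc, hUne] with n hcn hnen
    rw [hν' n hnen]
    have hS := sq_card_le_integral_specMeasure (A n) hnen v N
      (Finset.Icc (a n - fun _ => (R : ℤ)) (b n + fun _ => (R : ℤ))) (by
        intro k hk y hy
        simp only [hA, Finset.mem_filter, Finset.mem_Icc] at hy
        rw [Finset.mem_Icc]
        refine ⟨fun i => ?_, fun i => ?_⟩
        · have : a n i ≤ y i := hy.1.1 i
          have := abs_le.1 (hR k hk i)
          simp only [Pi.sub_apply, Pi.add_apply]; omega
        · have : y i ≤ b n i := hy.1.2 i
          have := abs_le.1 (hR k hk i)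
          simp only [Pi.add_apply]; omega)
    rw [hAd, lt_div_iff₀ (hIpos n)] at hcn
    rw [div_mul_eq_mul_div, le_div_iff₀ (hIpos n)]
    refine le_trans ?_ hS
    have := mul_le_mul_of_nonneg_left hcn.le (sq_nonneg (N : ℝ))
    linarith

/-! ### Recurrence and the conclusion -/

/-- Recurrence along ergodic sequences in `ℤ^ℓ`. -/
theorem sq_upperBanachDensity_le_liminf {v : ℕ → Fin ℓ → ℤ}
    (hv : ∀ θ : UnitAddTorus (Fin ℓ), θ ≠ 0 →
      CesaroZero (fun n => UnitAddTorus.mFourier (v n) θ)) (E : Set (Fin ℓ → ℤ)) :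
    upperBanachDensity E ^ 2 ≤ liminf (fun N : ℕ => (N : ℝ)⁻¹ * ∑ n ∈ Finset.range N,
      upperBanachDensity (E ∩ {x | x + v n ∈ E})) atTop := by
  set D : ℕ → ℝ := fun N => (N : ℝ)⁻¹ * ∑ n ∈ Finset.range N,
      upperBanachDensity (E ∩ {x | x + v n ∈ E}) with hD
  have hD0 : ∀ N, 0 ≤ D N := fun N =>
    mul_nonneg (by positivity) (Finset.sum_nonneg fun n _ => upperBanachDensity_nonneg _)
  have hD1 : ∀ N, D N ≤ 1 := fun N => by
    rw [hD]
    simp only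
    rw [inv_mul_eq_div]
    refine div_le_one_of_le₀ ?_ (by positivity)
    simpa using Finset.sum_le_sum (s := Finset.range N) fun n _ =>
      upperBanachDensity_le_one (E ∩ {x | x + v n ∈ E})
  have hcob : IsCoboundedUnder (· ≥ ·) atTop D :=
    (isBoundedUnder_of (r := (· ≤ ·)) ⟨1, hD1⟩).isCoboundedUnder_ge
  rcases (upperBanachDensity_nonneg E).eq_or_lt with h0 | hpos
  · rw [← h0]
    exact le_liminf_of_le hcob (.of_forall fun N => by simpa using hD0 N)
  have hsq : Tendsto (fun c : ℝ => c ^ 2) (𝓝[<] upperBanachDensity E)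
      (𝓝 (upperBanachDensity E ^ 2)) := (continuous_pow 2).continuousAt.mono_left nhdsWithin_le_nhds
  refine le_of_tendsto hsq ?_
  filter_upwards [Ioo_mem_nhdsLT hpos] with c hc
  obtain ⟨ν, hνp, hν1, hν2⟩ := exists_spectral_measure hc.1.le hc.2
  set a : ℕ → UnitAddTorus (Fin ℓ) → ℂ := fun N x =>
    (N : ℝ)⁻¹ • ∑ n ∈ Finset.range N, UnitAddTorus.mFourier (v n) x with ha
  have hacont : ∀ N, Continuous (a N) := fun N => by
    simp only [ha]; fun_prop
  have hanorm : ∀ N x, ‖a N x‖ ≤ 1 := by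
    intro N x
    rw [ha, norm_smul, Real.norm_of_nonneg (by positivity), inv_mul_eq_div]
    refine div_le_one_of_le₀ ((norm_sum_le _ _).trans ?_) (by positivity)
    have : ∀ n ∈ Finset.range N, ‖UnitAddTorus.mFourier (v n) x‖ ≤ 1 := fun n _ =>
      ((UnitAddTorus.mFourier (v n)).norm_coe_le_norm x).trans UnitAddTorus.mFourier_norm.le
    simpa using Finset.sum_le_sum this
  have halim : ∀ x, Tendsto (fun N => a N x) atTop (𝓝 (Set.indicator {0} 1 x)) := by
    intro x
    by_cases hx : x = 0
    · subst hx
      rw [Set.indicator_of_mem (Set.mem_singleton _)]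
      refine tendsto_const_nhds.congr' ?_
      filter_upwards [eventually_gt_atTop 0] with N hN
      have hN' : (N : ℂ) ≠ 0 := by exact_mod_cast hN.ne'
      simp [ha, UnitAddTorus.mFourier, hN']
    · rw [Set.indicator_of_notMem (by simpa using hx)]
      exact hv x hx
  have hre : Tendsto (fun N => ∫ x, (a N x).re ∂ν) atTop
      (𝓝 (∫ x, Set.indicator {0} 1 x ∂ν)) := by
    refine tendsto_integral_of_dominated_convergence (fun _ => 1)
      (fun N => (Complex.continuous_re.comp (hacont N)).aestronglyMeasurable) (integrable_const _)
      (fun N => .of_forall fun x => (Complex.abs_re_le_norm _).trans (hanorm N x))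
      (.of_forall fun x => ?_)
    have := (Complex.continuous_re.tendsto _).comp (halim x)
    have e : (Set.indicator {0} 1 x : ℂ).re = Set.indicator {0} 1 x := by
      by_cases hx : x = 0 <;> simp [hx]
    rwa [e] at this
  have hsqn : Tendsto (fun N => ∫ x, ‖a N x‖ ^ 2 ∂ν) atTop
      (𝓝 (∫ x, Set.indicator {0} 1 x ∂ν)) := by
    refine tendsto_integral_of_dominated_convergence (fun _ => 1)
      (fun N => ((hacont N).norm.pow 2).aestronglyMeasurable) (integrable_const _)
      (fun N => .of_forall fun x => ?_) (.of_forall fun x => ?_)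
    · rw [Real.norm_of_nonneg (by positivity)]
      exact pow_le_one₀ (norm_nonneg _) (hanorm N x)
    · have := (halim x).norm.pow 2
      have e : ‖(Set.indicator {0} 1 x : ℂ)‖ ^ 2 = Set.indicator {0} 1 x := by
        by_cases hx : x = 0 <;> simp [hx]
      rwa [e] at this
  -- The mean-square lower bound survives in the limit, where the squared averages become the
  -- indicator of the origin: ν{0} ≥ c.
  have hmass : c ≤ ∫ x, Set.indicator {0} 1 x ∂ν := by
    refine ge_of_tendsto hsqn ?_
    filter_upwards [eventually_gt_atTop 0] with N hN
    have hN' : (0 : ℝ) < N := by exact_mod_cast hN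
    have h := hν2 v N
    have e : ∀ x, ‖a N x‖ ^ 2 = ((N : ℝ)⁻¹) ^ 2 *
        ‖∑ n ∈ Finset.range N, UnitAddTorus.mFourier (v n) x‖ ^ 2 := fun x => by
      rw [ha, norm_smul, Real.norm_of_nonneg (by positivity), mul_pow]
    simp only [e, integral_const_mul]
    rw [inv_pow, ← div_eq_inv_mul, le_div_iff₀ (by positivity)]
    exact h
  have hlow : ∀ N, c * ∫ x, (a N x).re ∂ν ≤ D N := by
    intro N
    have hint : ∀ k : Fin ℓ → ℤ, Integrable (UnitAddTorus.mFourier k) ν := fun k =>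
      (ContinuousMap.continuous _).integrable_of_hasCompactSupport
        (HasCompactSupport.of_compactSpace _)
    have e : ∫ x, (a N x).re ∂ν = (N : ℝ)⁻¹ * ∑ n ∈ Finset.range N,
        (∫ x, UnitAddTorus.mFourier (v n) x ∂ν).re := by
      have : ∫ x, a N x ∂ν = (N : ℝ)⁻¹ • ∑ n ∈ Finset.range N,
          ∫ x, UnitAddTorus.mFourier (v n) x ∂ν := by
        simp only [ha, integral_smul]
        rw [integral_finsetSum _ fun n _ => hint _]
      have h2 : ∫ x, (a N x).re ∂ν = (∫ x, a N x ∂ν).re :=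
        integral_re (((hacont N)).integrable_of_hasCompactSupport
          (HasCompactSupport.of_compactSpace _))
      rw [h2, this, Complex.smul_re, Complex.re_sum, smul_eq_mul]
    rw [e, mul_left_comm, Finset.mul_sum]
    exact mul_le_mul_of_nonneg_left (Finset.sum_le_sum fun n _ => hν1 (v n)) (by positivity)
  -- One factor `c` comes from the correspondence, the other from the atom at the origin.
  have hlimc := hre.const_mul c
  calc c ^ 2 ≤ c * ∫ x, Set.indicator {0} 1 x ∂ν := by nlinarith [hc.1]
    _ = liminf (fun N => c * ∫ x, (a N x).re ∂ν) atTop := hlimc.liminf_eq.symm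
    _ ≤ liminf D atTop := liminf_le_liminf (.of_forall hlow) hlimc.isBoundedUnder_ge hcob

end Density

end TemperedFn

theorem corollaryC (ℓ : ℕ) (hℓ : 1 ≤ ℓ) (g : Fin ℓ → ℝ → ℝ)
    (hg : ∀ i, g i ∈ TemperedFn.classT)
    (hlt : ∀ i j : Fin ℓ, i < j → TemperedFn.SlowerThan (g j) (g i))
    (hcomb : ∀ c : Fin ℓ → ℝ, c ≠ 0 → (fun x : ℝ => ∑ i, c i * g i x) ∈ TemperedFn.classT)
    (E : Set (Fin ℓ → ℤ)) :
    TemperedFn.upperBanachDensity E ^ 2 ≤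
      liminf (fun N : ℕ => (1 / (N : ℝ)) * ∑ n ∈ Finset.Icc 1 N,
        TemperedFn.upperBanachDensity (E ∩ {x | x + (fun i => ⌊g i (n : ℝ)⌋) ∈ E})) atTop := by
  have hfloor : ∀ θ : UnitAddTorus (Fin ℓ), θ ≠ 0 → TemperedFn.CesaroZero fun n =>
      UnitAddTorus.mFourier (fun i => ⌊g i ((n + 1 : ℕ) : ℝ)⌋) θ := by
    intro θ hθ
    have hexp : ∀ c : Fin ℓ → ℝ, c ≠ 0 →
        TemperedFn.CesaroZero fun n => TemperedFn.expChar (∑ i, c i * g i (n : ℝ)) := by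
      intro c hc
      have := TemperedFn.classT.cesaroZero (hcomb c hc)
      exact this
    have h := TemperedFn.cesaroZero_floor (G := fun (n : ℕ) i => g i (n : ℝ)) hexp hθ
    -- The averages in the statement start at n = 1, those of `CesaroZero` at n = 0.
    exact h.shift (fun n =>
      ((UnitAddTorus.mFourier _).norm_coe_le_norm θ).trans UnitAddTorus.mFourier_norm.le) 1
  have hsum : ∀ (f : ℕ → ℝ) (N : ℕ),
      (N : ℝ)⁻¹ * ∑ n ∈ Finset.range N, f (n + 1) = (1 / (N : ℝ)) * ∑ n ∈ Finset.Icc 1 N, f n := by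
    intro f N
    rw [one_div, Finset.range_eq_Ico, Finset.sum_Ico_add' f, zero_add,
      Finset.Ico_add_one_right_eq_Icc]
  simp only [← hsum (fun n => TemperedFn.upperBanachDensity
    (E ∩ {x | x + (fun i => ⌊g i (n : ℝ)⌋) ∈ E}))]
  exact TemperedFn.sq_upperBanachDensity_le_liminf hfloor E
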